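/- Let $D$ be an integral domain with quotient field $K$. For a nonzero fractional ideal $A$ of $D$ put $A^{-1}=\{z\in K : zA\subseteq D\}$, $A^v=(A^{-1})^{-1}$ and $A^t=\bigcup\{F^v : F\subseteq A,\ F\in f(D)\}$, where $f(D)$ is the set of nonzero finitely generated $D$-submodules of $K$. Call $A$ $v$-invertible (resp. $t$-invertible) if $(AA^{-1})^v=D$ (resp. $(AA^{-1})^t=D$), and $v$-finite if $A^v=F^v$ for some $F\in f(D)$. The domain $D$ is called: - a $v$-finite conductor domain if $aD\cap bD$ is $v$-finite for all nonzero $a,b\in D$; - a $v$-domain (resp. a P$v$MD) if every $F\in f(D)$ is $v$-invertible (resp. $t$-invertible); - essential if $D$ is an intersection of valuation overrings of the form $D_P$ with $P$ a prime ideal of $D$; - a P-domain if every ring of fractions $D_S$ (with $S$ a multiplicative set, $0\notin S$) is essential; - locally a P$v$MD (resp. a $v$-domain, a GCD domain) if $D_P$ is a P$v$MD (resp. a $v$-domain, a GCD domain) for every prime ideal $P$ of $D$; - Krull if $D$ is the intersection of a (possibly empty) family of discrete rank-one valuation overrings such that each nonzero element of $D$ is a unit in all but finitely many of them; - completely integrally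 closed (CIC) if every $z\in K$ for which there is a nonzero $a\in D$ with $az^n\in D$ for all $n\ge 0$ lies in $D$; - a generalized GCD (GGCD) domain if the intersection of any two invertible integral ideals of $D$ is invertible. Every Noetherian domain is a $v$-finite conductor domain, and the following hold. (1) If $D$ is a $v$-finite conductor domain, then the following are equivalent: (a) $D$ is a P$v$MD; (b) $D$ is locally a P$v$MD; (c) $D$ is a P-domain; (d) $D$ is essential; (e) $D$ is locally a $v$-domain; (f) $D$ is a $v$-domain. (2) If $D$ is Noetherian, then conditions (a)–(f) are also equivalent to each of: (g) $D$ is a Krull domain; (h) $D$ is a CIC domain; (i) $D$ is integrally closed. (3) If $D$ is a $v$-finite conductor domain, then the following are equivalent: (j) $D$ is a GGCD domain; (k) $D$ is locally a GCD domain. -/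

import Mathlib

open scoped nonZeroDivisors

namespace MultIdeal

section Operations

variable {D : Type*} [CommRing D] [IsDomain D] {K : Type*} [Field K] [Algebra D K]
  [IsFractionRing D K]

/-- Membership in `f(D)`: the nonzero finitely generated `D`-submodules of `K`
(such a submodule is automatically a fractional ideal). -/
def IsFG (F : FractionalIdeal D⁰ K) : Prop :=
  F ≠ 0 ∧ (F : Submodule D K).FG

/-- The `v`-operation `A ↦ (A⁻¹)⁻¹`, where `A⁻¹ = (D : A)`. -/
noncomputable def vClosure (A : FractionalIdeal D⁰ K) : FractionalIdeal D⁰ K :=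
  (A⁻¹)⁻¹

/-- The `t`-operation: `A ↦ ⋃ {F^v | F ∈ f(D), F ⊆ A}`. -/
noncomputable def tClosure (A : FractionalIdeal D⁰ K) : Set K :=
  ⋃ F ∈ {F : FractionalIdeal D⁰ K | IsFG F ∧ F ≤ A}, (vClosure F : Set K)

/-- `A` is `v`-finite if `A^v = F^v` for some `F ∈ f(D)`. -/
def IsVFinite (A : FractionalIdeal D⁰ K) : Prop :=
  ∃ F : FractionalIdeal D⁰ K, IsFG F ∧ vClosure F = vClosure A

/-- `A` is `v`-invertible if `(A A⁻¹)^v = D`. -/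
def IsVInvertible (A : FractionalIdeal D⁰ K) : Prop :=
  vClosure (A * A⁻¹) = 1

/-- `A` is `t`-invertible if `(A A⁻¹)^t = D`. -/
def IsTInvertible (A : FractionalIdeal D⁰ K) : Prop :=
  tClosure (A * A⁻¹) = Set.range (algebraMap D K)

end Operations

section Classes

variable (D : Type*) [CommRing D] [IsDomain D]

/-- The intersection of two nonzero principal ideals is `v`-finite. -/
def IsVFiniteConductorDomain : Prop :=
  ∀ a b : D, a ≠ 0 → b ≠ 0 →
    IsVFinite ((Ideal.span {a} ⊓ Ideal.span {b} : Ideal D) : FractionalIdeal D⁰ (FractionRing D))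

/-- `v`-domains: every `F ∈ f(D)` is `v`-invertible. -/
def IsVDomain : Prop :=
  ∀ F : FractionalIdeal D⁰ (FractionRing D), IsFG F → IsVInvertible F

/-- Prüfer `v`-multiplication domains: every `F ∈ f(D)` is `t`-invertible. -/
def IsPvMD : Prop :=
  ∀ F : FractionalIdeal D⁰ (FractionRing D), IsFG F → IsTInvertible F

/-- A valuation overring `V` of `D` is essential if `V = D_P` (inside the quotient field) for some
prime ideal `P` of `D`. -/
def IsEssentialValuationOverring (V : ValuationSubring (FractionRing D)) : Prop :=
  ∃ P : Ideal D, P.IsPrime ∧ ∀ x : FractionRing D, x ∈ V ↔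
    ∃ a s : D, s ∉ P ∧ x = algebraMap D (FractionRing D) a / algebraMap D (FractionRing D) s

/-- Essential domains: `D` is an intersection of essential valuation overrings. -/
def IsEssentialDomain : Prop :=
  ∃ S : Set (ValuationSubring (FractionRing D)),
    (∀ V ∈ S, IsEssentialValuationOverring D V) ∧
    ∀ x : FractionRing D, (∀ V ∈ S, x ∈ V) ↔ x ∈ Set.range (algebraMap D (FractionRing D))

/-- P-domains: every ring of fractions of `D` is an essential domain. -/
def IsPDomain : Prop :=
  ∀ (S : Submonoid D) (hS : S ≤ D⁰),
    haveI : IsDomain (Localization S) := IsLocalization.isDomain_localization hS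
    IsEssentialDomain (Localization S)

/-- `D_P` is a P`v`MD for every prime ideal `P` of `D`. -/
def IsLocallyPvMD : Prop :=
  ∀ (P : Ideal D) [P.IsPrime], IsPvMD (Localization.AtPrime P)

/-- `D_P` is a `v`-domain for every prime ideal `P` of `D`. -/
def IsLocallyVDomain : Prop :=
  ∀ (P : Ideal D) [P.IsPrime], IsVDomain (Localization.AtPrime P)

/-- Krull domains: `D` is the intersection of a family of discrete (rank one) valuation overrings
such that every nonzero element of `D` is a unit in all but finitely many of them. The family may
be empty, in which case `D` is a field. -/
def IsKrullDomain : Prop :=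
  ∃ S : Set (ValuationSubring (FractionRing D)),
    (∀ V ∈ S, IsDiscreteValuationRing V) ∧
    (∀ x : FractionRing D,
      (∀ V ∈ S, x ∈ V) ↔ x ∈ Set.range (algebraMap D (FractionRing D))) ∧
    ∀ x : D, x ≠ 0 →
      {V ∈ S | V.valuation (algebraMap D (FractionRing D) x) ≠ 1}.Finite

/-- Completely integrally closed domains: `z` in the quotient field lies in `D` as soon as
there is a nonzero `a ∈ D` with `a z ^ n ∈ D` for all `n`. -/
def IsCICDomain : Prop :=
  completeIntegralClosure D (FractionRing D) = ⊥

/-- Generalized GCD domains: the intersection of two (integral) invertible ideals is invertible. -/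
def IsGGCDDomain : Prop :=
  ∀ I J : Ideal D,
    IsUnit (I : FractionalIdeal D⁰ (FractionRing D)) →
    IsUnit (J : FractionalIdeal D⁰ (FractionRing D)) →
    IsUnit ((I ⊓ J : Ideal D) : FractionalIdeal D⁰ (FractionRing D))

/-- `D_P` is a GCD domain for every prime ideal `P` of `D`. -/
def IsLocallyGCDDomain : Prop :=
  ∀ (P : Ideal D) [P.IsPrime], IsGCDMonoid (Localization.AtPrime P)

end Classes

end MultIdeal

/-!
The `v`- and `t`-notions only involve the subring `O = D` of the quotient field `K` and finite
sets of generators, so `v`-domains and P`v`MDs are described by conditions on subrings of a field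
(`IsVSubring`, `IsPvMSubring`). All rings of fractions `D_S` are viewed inside the same `K`
(`locSubring`), where inverses of finitely generated fractional ideals visibly commute with
localization. This gives that P`v`MDs are stable under localization and that a locally `v`-domain
is a `v`-domain.

The link with valuations is made by the ideals that are maximal among the `t`-proper ones
(`IsTProper`). They exist by Zorn's lemma, are prime, and `D` is the intersection of its
localizations at them, because the conductor `{d | d x ∈ D}` of an `x ∉ D` is `t`-proper. If the
ideals `(z, 1)` are `t`-invertible, then these localizations are valuation rings
(`isValuationPrime_of_maximal_isTProper`), so a P`v`MD is essential. Conversely, a finitely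
generated `F` becomes principal over a valuation ring `D_P`, and then `F F⁻¹ ⊄ P`; hence an
essential domain is a `v`-domain, and a domain whose localizations at the maximal `t`-proper
ideals are valuation rings is a P`v`MD (`isPvMSubring_of_forall_isValuationPrime`). The conductor
hypothesis enters only in `IsVDomain.isPvMD`: the inverse of `(a / b, 1)` is `a⁻¹ (a D ∩ b D)`, so
in a `v`-domain it is enough that `a D ∩ b D` is `v`-finite to make `(a / b, 1)` `t`-invertible.

In the Noetherian case, a `v`-domain is integrally closed since `x F ⊆ F` for `F = D[x]`, integral
and almost integral elements coincide, and a completely integrally closed domain is a `v`-domain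
since `x F F⁻¹ ⊆ D` makes `x` almost integral. The valuation rings `D_P` with `P ≠ 0` are then
discrete and exhibit a P`v`MD as a Krull domain.

If `D` is a GGCD domain, the localization of the invertible ideal `a D ∩ b D` at `P` is principal,
generated by a least common multiple. Conversely, a locally GCD domain is locally a `v`-domain, so
under the conductor hypothesis it is a P`v`MD. For invertible `I` and `J` the intersection `I ∩ J`
is the inverse of the finitely generated `I⁻¹ + J⁻¹`, it is locally principal, and in a P`v`MD its
own inverse commutes with localization, so it is invertible (`isUnit_inv_of_isFG`).
-/

namespace MultIdeal

/-! ### Finite sets of generators over a subring of a field -/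

section Subrings

variable {K : Type*} [Field K]

/-- The condition defining a `v`-domain, for a subring `O` of a field `K`: for every finite
`T ⊆ K` that is not contained in `{0}`, the fractional ideal `F` generated by `T` satisfies
`(F F⁻¹)⁻¹ ⊆ O`. Everything is phrased with the generators `T` of `F`. -/
def IsVSubring (O : Subring K) : Prop :=
  ∀ T : Finset K, (∃ t ∈ T, t ≠ 0) →
    ∀ x, (∀ t ∈ T, ∀ y, (∀ u ∈ T, y * u ∈ O) → x * (t * y) ∈ O) → x ∈ O

/-- `t`-invertibility of the fractional ideal `F` generated by `T`, with respect to a subring `O`: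
there is a finite `Y ⊆ F⁻¹` such that the finitely generated ideal `F Y` has inverse `O`. -/
def IsTInvertibleSet (O : Subring K) (T : Finset K) : Prop :=
  ∃ Y : Finset K, (∀ y ∈ Y, ∀ u ∈ T, y * u ∈ O) ∧
    ∀ x, (∀ t ∈ T, ∀ y ∈ Y, x * (t * y) ∈ O) → x ∈ O

/-- The condition defining a P`v`MD, for a subring of a field. -/
def IsPvMSubring (O : Subring K) : Prop :=
  ∀ T : Finset K, (∃ t ∈ T, t ≠ 0) → IsTInvertibleSet O T

lemma IsPvMSubring.isVSubring {O : Subring K} (h : IsPvMSubring O) : IsVSubring O := by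
  intro T hT x hx
  obtain ⟨Y, hY, hY'⟩ := h T hT
  exact hY' x fun t ht y hy ↦ hx t ht y (hY y hy)

lemma IsVSubring.map {L : Type*} [Field L] (e : K ≃+* L) {O : Subring K} {O' : Subring L}
    (he : ∀ x, e x ∈ O' ↔ x ∈ O) (h : IsVSubring O) : IsVSubring O' := by
  classical
  intro T ⟨t₀, ht₀, ht₀'⟩ x hx
  have hs (x : L) : e.symm x ∈ O ↔ x ∈ O' := by rw [← he, e.apply_symm_apply]
  rw [← hs]
  refine h (T.image e.symm) ⟨e.symm t₀, Finset.mem_image_of_mem _ ht₀, by simpa using ht₀'⟩ _ ?_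
  intro t ht y hy
  obtain ⟨t, htT, rfl⟩ := Finset.mem_image.mp ht
  have := hx t htT (e y) fun u hu ↦ by
    have := hy _ (Finset.mem_image_of_mem e.symm hu)
    rwa [← he, map_mul, e.apply_symm_apply] at this
  rw [← hs] at this
  simpa using this

lemma IsPvMSubring.map {L : Type*} [Field L] (e : K ≃+* L) {O : Subring K} {O' : Subring L}
    (he : ∀ x, e x ∈ O' ↔ x ∈ O) (h : IsPvMSubring O) : IsPvMSubring O' := by
  classical
  intro T ⟨t₀, ht₀, ht₀'⟩
  have hs (x : L) : e.symm x ∈ O ↔ x ∈ O' := by rw [← he, e.apply_symm_apply]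
  obtain ⟨Y, hY, hY'⟩ :=
    h (T.image e.symm) ⟨e.symm t₀, Finset.mem_image_of_mem _ ht₀, by simpa using ht₀'⟩
  refine ⟨Y.image e, ?_, fun x hx ↦ ?_⟩
  · intro y hy u hu
    obtain ⟨y, hyY, rfl⟩ := Finset.mem_image.mp hy
    have := hY y hyY _ (Finset.mem_image_of_mem e.symm hu)
    rwa [← he, map_mul, e.apply_symm_apply] at this
  · rw [← hs]
    refine hY' _ fun t ht y hy ↦ ?_
    obtain ⟨t, htT, rfl⟩ := Finset.mem_image.mp ht
    have := hx t htT _ (Finset.mem_image_of_mem e hy)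
    rw [← hs] at this
    simpa using this

/-- The finite subsets of `F⁻¹` witnessing that single elements lie in `F F⁻¹` can be merged. -/
lemma exists_finset_forall_mul_mem (O : Subring K) (T G : Finset K) (p : K → Prop)
    (h : ∀ g ∈ G, ∃ Y : Finset K, (∀ y ∈ Y, p y) ∧
      ∀ x, (∀ t ∈ T, ∀ y ∈ Y, x * (t * y) ∈ O) → x * g ∈ O) :
    ∃ Y : Finset K, (∀ y ∈ Y, p y) ∧
      ∀ x, (∀ t ∈ T, ∀ y ∈ Y, x * (t * y) ∈ O) → ∀ g ∈ G, x * g ∈ O := by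
  classical
  choose! Y hY hY' using h
  refine ⟨G.biUnion Y, fun y hy ↦ ?_, fun x hx g hg ↦ hY' g hg x fun t ht y hy ↦ ?_⟩
  · obtain ⟨g, hg, hy⟩ := Finset.mem_biUnion.mp hy
    exact hY g hg y hy
  · exact hx t ht y (Finset.mem_biUnion.mpr ⟨g, hg, hy⟩)

end Subrings

section CommRing

variable {D : Type*} [CommRing D] {K : Type*} [Field K] [Algebra D K]

lemma mem_one_iff_mem_range {x : K} :
    x ∈ (1 : FractionalIdeal D⁰ K) ↔ x ∈ (algebraMap D K).range := by
  rw [FractionalIdeal.mem_one_iff]; rfl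

lemma mem_range_algEquiv_iff {L : Type*} [Field L] [Algebra D L] (e : K ≃ₐ[D] L) (x : K) :
    (e : K ≃+* L) x ∈ (algebraMap D L).range ↔ x ∈ (algebraMap D K).range := by
  constructor
  · rintro ⟨d, hd⟩
    refine ⟨d, e.injective ?_⟩
    simpa using hd
  · rintro ⟨d, rfl⟩
    exact ⟨d, by simp⟩

/-- The fractional ideal generated by a finite set. -/
lemma exists_coe_eq_span [IsFractionRing D K] (T : Finset K) :
    ∃ F : FractionalIdeal D⁰ K, (F : Submodule D K) = Submodule.span D (T : Set K) :=
  ⟨⟨_, FractionalIdeal.isFractional_of_fg (S := D⁰) ⟨T, rfl⟩⟩, rfl⟩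

lemma isFG_iff_exists_span {F : FractionalIdeal D⁰ K} :
    IsFG F ↔ ∃ T : Finset K, (∃ t ∈ T, t ≠ 0) ∧
      (F : Submodule D K) = Submodule.span D (T : Set K) := by
  constructor
  · rintro ⟨h0, T, hT⟩
    refine ⟨T, ?_, hT.symm⟩
    by_contra! h
    refine h0 (FractionalIdeal.coeToSubmodule_injective ?_)
    change (F : Submodule D K) = ((0 : FractionalIdeal D⁰ K) : Submodule D K)
    rw [← hT, FractionalIdeal.coe_zero, Submodule.span_eq_bot]
    exact h
  · rintro ⟨T, ⟨t, ht, ht0⟩, hT⟩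
    refine ⟨?_, T, hT.symm⟩
    rintro rfl
    have : t ∈ Submodule.span D (T : Set K) := Submodule.subset_span ht
    rw [← hT, FractionalIdeal.coe_zero, Submodule.mem_bot] at this
    exact ht0 this

lemma fractionalIdeal_mul_ne_zero {A B : FractionalIdeal D⁰ K} (hA : A ≠ 0) (hB : B ≠ 0) :
    A * B ≠ 0 := by
  rw [Ne, FractionalIdeal.eq_zero_iff] at *
  push Not at *
  obtain ⟨a, ha, ha0⟩ := hA
  obtain ⟨b, hb, hb0⟩ := hB
  exact ⟨a * b, FractionalIdeal.mul_mem_mul ha hb, mul_ne_zero ha0 hb0⟩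

end CommRing

section Bridge

variable {D : Type*} [CommRing D] [IsDomain D] {K : Type*} [Field K] [Algebra D K]
  [IsFractionRing D K]

lemma mem_inv_iff_of_coe_eq_span {F : FractionalIdeal D⁰ K} (hF : F ≠ 0) {T : Finset K}
    (hT : (F : Submodule D K) = Submodule.span D (T : Set K)) {x : K} :
    x ∈ F⁻¹ ↔ ∀ t ∈ T, x * t ∈ (algebraMap D K).range := by
  rw [FractionalIdeal.mem_inv_iff hF]
  constructor
  · intro h t ht
    refine mem_one_iff_mem_range.mp (h t ?_)
    rw [← FractionalIdeal.mem_coe, hT]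
    exact Submodule.subset_span ht
  · intro h y hy
    rw [← FractionalIdeal.mem_coe, hT] at hy
    rw [mem_one_iff_mem_range]
    induction hy using Submodule.span_induction with
    | mem t ht => exact h t ht
    | zero => simp
    | add a b _ _ ha hb => rw [mul_add]; exact add_mem ha hb
    | smul d a _ ha =>
      rw [Algebra.smul_def, mul_left_comm]
      exact mul_mem ⟨d, rfl⟩ ha

lemma inv_ne_zero_of_ne_zero {A : FractionalIdeal D⁰ K} (hA : A ≠ 0) : A⁻¹ ≠ 0 := by
  obtain ⟨d, hd, h⟩ := A.2
  have hd' : algebraMap D K d ∈ A⁻¹ := by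
    rw [FractionalIdeal.mem_inv_iff hA]
    intro y hy
    rw [mem_one_iff_mem_range, ← Algebra.smul_def]
    exact h y hy
  rintro h0
  rw [h0, FractionalIdeal.mem_zero_iff] at hd'
  exact nonZeroDivisors.ne_zero hd (IsFractionRing.injective D K (by simpa using hd'))

lemma le_vClosure {A : FractionalIdeal D⁰ K} (hA : A ≠ 0) : A ≤ vClosure A := by
  intro x hx
  rw [vClosure, FractionalIdeal.mem_inv_iff (inv_ne_zero_of_ne_zero hA)]
  intro y hy
  rw [mul_comm]
  exact (FractionalIdeal.mem_inv_iff hA).mp hy x hx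

lemma inv_vClosure {A : FractionalIdeal D⁰ K} (hA : A ≠ 0) : (vClosure A)⁻¹ = A⁻¹ := by
  have h := inv_ne_zero_of_ne_zero hA
  refine le_antisymm ?_ (le_vClosure h)
  exact FractionalIdeal.inv_anti_mono hA (inv_ne_zero_of_ne_zero h) (le_vClosure hA)

lemma mul_inv_le_one (A : FractionalIdeal D⁰ K) : A * A⁻¹ ≤ 1 :=
  FractionalIdeal.mul_one_div_le_one

lemma one_inv_eq : (1 : FractionalIdeal D⁰ K)⁻¹ = 1 := by
  rw [FractionalIdeal.inv_eq, FractionalIdeal.div_one]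

lemma vClosure_eq_one_iff {A : FractionalIdeal D⁰ K} (hA : A ≠ 0) (hA1 : A ≤ 1) :
    vClosure A = 1 ↔ A⁻¹ ≤ 1 := by
  have h1 : 1 ≤ A⁻¹ := by
    have := FractionalIdeal.inv_anti_mono hA one_ne_zero hA1
    rwa [one_inv_eq] at this
  constructor
  · intro h
    rw [← inv_vClosure hA, h, one_inv_eq]
  · intro h
    rw [vClosure, le_antisymm h h1, one_inv_eq]

lemma mem_mul_inv_inv_iff {F : FractionalIdeal D⁰ K} (hF : F ≠ 0) {T : Finset K}
    (hT : (F : Submodule D K) = Submodule.span D (T : Set K)) {x : K} :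
    x ∈ (F * F⁻¹)⁻¹ ↔ ∀ t ∈ T, ∀ y, (∀ u ∈ T, y * u ∈ (algebraMap D K).range) →
      x * (t * y) ∈ (algebraMap D K).range := by
  have h0 : F * F⁻¹ ≠ 0 := fractionalIdeal_mul_ne_zero hF (inv_ne_zero_of_ne_zero hF)
  rw [FractionalIdeal.mem_inv_iff h0]
  constructor
  · intro h t ht y hy
    refine mem_one_iff_mem_range.mp (h _ (FractionalIdeal.mul_mem_mul ?_ ?_))
    · rw [← FractionalIdeal.mem_coe, hT]
      exact Submodule.subset_span ht
    · rwa [mem_inv_iff_of_coe_eq_span hF hT]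
  · intro h z hz
    rw [mem_one_iff_mem_range]
    refine FractionalIdeal.mul_induction_on hz (fun f hf y hy ↦ ?_) fun a b ha hb ↦ ?_
    · rw [mem_inv_iff_of_coe_eq_span hF hT] at hy
      have : x * y ∈ F⁻¹ := by
        rw [mem_inv_iff_of_coe_eq_span hF hT]
        intro t ht
        rw [mul_assoc, mul_comm y]
        exact h t ht y hy
      rw [mul_left_comm, mul_comm]
      rw [FractionalIdeal.mem_inv_iff hF] at this
      exact mem_one_iff_mem_range.mp (by simpa [mul_assoc] using this f hf)
    · rw [mul_add]; exact add_mem ha hb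

lemma isVInvertible_iff {F : FractionalIdeal D⁰ K} (hF : F ≠ 0) {T : Finset K}
    (hT : (F : Submodule D K) = Submodule.span D (T : Set K)) :
    IsVInvertible F ↔
      ∀ x, (∀ t ∈ T, ∀ y, (∀ u ∈ T, y * u ∈ (algebraMap D K).range) →
        x * (t * y) ∈ (algebraMap D K).range) → x ∈ (algebraMap D K).range := by
  rw [IsVInvertible,
    vClosure_eq_one_iff (fractionalIdeal_mul_ne_zero hF (inv_ne_zero_of_ne_zero hF))
    (mul_inv_le_one F)]
  refine forall_congr' fun x ↦ ?_
  rw [← mem_mul_inv_inv_iff hF hT, ← mem_one_iff_mem_range]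

lemma isTInvertible_iff {F : FractionalIdeal D⁰ K} (hF : F ≠ 0) {T : Finset K}
    (hT : (F : Submodule D K) = Submodule.span D (T : Set K)) :
    IsTInvertible F ↔ IsTInvertibleSet (algebraMap D K).range T := by
  classical
  constructor
  · intro h
    have h1 : (1 : K) ∈ tClosure (F * F⁻¹) := by
      rw [h]; exact ⟨1, map_one _⟩
    simp only [tClosure, Set.mem_iUnion, Set.mem_ofPred_eq] at h1
    obtain ⟨G, ⟨hG, hGF⟩, h1⟩ := h1
    obtain ⟨H, -, hH⟩ := isFG_iff_exists_span.mp hG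
    obtain ⟨Y, hY, hY'⟩ := exists_finset_forall_mul_mem (algebraMap D K).range T H
      (fun y ↦ y ∈ F⁻¹) <| by
      intro g hg
      have hg : g ∈ F * F⁻¹ := by
        refine hGF ?_
        change g ∈ (G : Submodule D K)
        rw [hH]
        exact Submodule.subset_span hg
      refine FractionalIdeal.mul_induction_on hg (fun f hf y hy ↦ ?_) fun a b ha hb ↦ ?_
      · refine ⟨{y}, by simpa using hy, fun x hx ↦ ?_⟩
        have : x * y ∈ F⁻¹ := by
          rw [mem_inv_iff_of_coe_eq_span hF hT]
          intro t ht
          rw [mul_assoc, mul_comm y]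
          exact hx t ht y (Finset.mem_singleton_self y)
        rw [FractionalIdeal.mem_inv_iff hF] at this
        have := mem_one_iff_mem_range.mp (this f hf)
        rwa [mul_assoc, mul_comm y] at this
      · obtain ⟨Y₁, h₁, h₁'⟩ := ha
        obtain ⟨Y₂, h₂, h₂'⟩ := hb
        refine ⟨Y₁ ∪ Y₂, fun y hy ↦ ?_, fun x hx ↦ ?_⟩
        · exact (Finset.mem_union.mp hy).elim (h₁ y) (h₂ y)
        · rw [mul_add]
          exact add_mem (h₁' x fun t ht y hy ↦ hx t ht y (Finset.mem_union_left _ hy))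
            (h₂' x fun t ht y hy ↦ hx t ht y (Finset.mem_union_right _ hy))
    refine ⟨Y, fun y hy ↦ (mem_inv_iff_of_coe_eq_span hF hT).mp (hY y hy), fun x hx ↦ ?_⟩
    have hx : x ∈ G⁻¹ := (mem_inv_iff_of_coe_eq_span hG.1 hH).mpr (hY' x hx)
    have := (FractionalIdeal.mem_inv_iff (inv_ne_zero_of_ne_zero hG.1)).mp h1 x hx
    rwa [one_mul, mem_one_iff_mem_range] at this
  · rintro ⟨Y, hY, hY'⟩
    -- A nonzero element is added to `Y`, so that it generates a nonzero fractional ideal; this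
    -- matters when `D` is a field, where `Y` may be empty.
    obtain ⟨y₀, hy₀, hy₀'⟩ : ∃ y ∈ F⁻¹, y ≠ 0 := by
      by_contra! h
      exact inv_ne_zero_of_ne_zero hF (FractionalIdeal.eq_zero_iff.mpr h)
    obtain ⟨H, hH⟩ := exists_coe_eq_span (D := D) (insert y₀ Y)
    have hHF : H ≤ F⁻¹ := by
      rw [← FractionalIdeal.coe_le_coe, hH, Submodule.span_le]
      intro y hy
      rcases Finset.mem_insert.mp (Finset.mem_coe.mp hy) with rfl | hy
      · exact hy₀
      · exact (mem_inv_iff_of_coe_eq_span hF hT).mpr (hY y hy)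
    have hH0 : IsFG H :=
      isFG_iff_exists_span.mpr ⟨_, ⟨y₀, Finset.mem_insert_self _ _, hy₀'⟩, hH⟩
    have hG0 : F * H ≠ 0 := fractionalIdeal_mul_ne_zero hF hH0.1
    have hGF : F * H ≤ F * F⁻¹ := mul_le_mul_right hHF F
    have hG : IsFG (F * H) := by
      refine ⟨hG0, ?_⟩
      rw [FractionalIdeal.coe_mul]
      exact Submodule.FG.mul ⟨T, hT.symm⟩ hH0.2
    have hGinv : (F * H)⁻¹ ≤ 1 := by
      intro x hx
      rw [mem_one_iff_mem_range]
      refine hY' x fun t ht y hy ↦ mem_one_iff_mem_range.mp ?_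
      refine (FractionalIdeal.mem_inv_iff hG0).mp hx _ (FractionalIdeal.mul_mem_mul ?_ ?_)
      · rw [← FractionalIdeal.mem_coe, hT]; exact Submodule.subset_span ht
      · rw [← FractionalIdeal.mem_coe, hH]
        exact Submodule.subset_span (Finset.mem_coe.mpr (Finset.mem_insert_of_mem hy))
    have h1 (E : FractionalIdeal D⁰ K) (hE : IsFG E) (hE' : E ≤ F * F⁻¹) : vClosure E ≤ 1 := by
      have h10 : (1 : FractionalIdeal D⁰ K) ≠ 0 := one_ne_zero
      have h := FractionalIdeal.inv_anti_mono hE.1 h10 (hE'.trans (mul_inv_le_one F))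
      have := FractionalIdeal.inv_anti_mono (inv_ne_zero_of_ne_zero h10)
        (inv_ne_zero_of_ne_zero hE.1) h
      rwa [one_inv_eq, one_inv_eq] at this
    ext x
    simp only [tClosure, Set.mem_iUnion, Set.mem_ofPred_eq]
    constructor
    · rintro ⟨E, ⟨hE, hE'⟩, hx⟩
      exact mem_one_iff_mem_range.mp (h1 E hE hE' hx)
    · intro hx
      refine ⟨F * H, ⟨hG, hGF⟩, ?_⟩
      rw [(vClosure_eq_one_iff hG0 (hGF.trans (mul_inv_le_one F))).mpr hGinv]
      exact mem_one_iff_mem_range.mpr hx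

variable (D K)

theorem isVDomain_iff : IsVDomain D ↔ IsVSubring (algebraMap D K).range := by
  let e := FractionRing.algEquiv D K
  trans IsVSubring (algebraMap D (FractionRing D)).range
  · constructor
    · intro h T hT x hx
      obtain ⟨F, hF⟩ := exists_coe_eq_span (D := D) T
      have hFG : IsFG F := isFG_iff_exists_span.mpr ⟨T, hT, hF⟩
      exact (isVInvertible_iff hFG.1 hF).mp (h F hFG) x hx
    · intro h F hFG
      obtain ⟨T, hT, hF⟩ := isFG_iff_exists_span.mp hFG
      exact (isVInvertible_iff hFG.1 hF).mpr (h T hT)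
  · exact ⟨fun h ↦ h.map (e : FractionRing D ≃+* K) (mem_range_algEquiv_iff e),
      fun h ↦ h.map (e.symm : K ≃+* FractionRing D) (mem_range_algEquiv_iff e.symm)⟩

theorem isPvMD_iff : IsPvMD D ↔ IsPvMSubring (algebraMap D K).range := by
  let e := FractionRing.algEquiv D K
  trans IsPvMSubring (algebraMap D (FractionRing D)).range
  · constructor
    · intro h T hT
      obtain ⟨F, hF⟩ := exists_coe_eq_span (D := D) T
      have hFG : IsFG F := isFG_iff_exists_span.mpr ⟨T, hT, hF⟩
      exact (isTInvertible_iff hFG.1 hF).mp (h F hFG)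
    · intro h F hFG
      obtain ⟨T, hT, hF⟩ := isFG_iff_exists_span.mp hFG
      exact (isTInvertible_iff hFG.1 hF).mpr (h T hT)
  · exact ⟨fun h ↦ h.map (e : FractionRing D ≃+* K) (mem_range_algEquiv_iff e),
      fun h ↦ h.map (e.symm : K ≃+* FractionRing D) (mem_range_algEquiv_iff e.symm)⟩

end Bridge

/-! ### Rings of fractions and maximal `t`-proper ideals -/

section Localization

variable {D : Type*} [CommRing D] (S : Submonoid D) (K : Type*) [Field K] [Algebra D K]

/-- The ring of fractions `D_S`, as a subring of a field `K` containing `D`: the elements that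
some `s ∈ S` multiplies into `D`. -/
def locSubring : Subring K where
  carrier := {x | ∃ s ∈ S, algebraMap D K s * x ∈ (algebraMap D K).range}
  one_mem' := ⟨1, one_mem S, 1, by simp⟩
  zero_mem' := ⟨1, one_mem S, 0, by simp⟩
  mul_mem' := by
    rintro a b ⟨s, hs, ha⟩ ⟨t, ht, hb⟩
    refine ⟨s * t, mul_mem hs ht, ?_⟩
    rw [map_mul, mul_mul_mul_comm]
    exact mul_mem ha hb
  add_mem' := by
    rintro a b ⟨s, hs, ha⟩ ⟨t, ht, hb⟩
    refine ⟨s * t, mul_mem hs ht, ?_⟩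
    have : algebraMap D K (s * t) * (a + b) = algebraMap D K t * (algebraMap D K s * a) +
        algebraMap D K s * (algebraMap D K t * b) := by
      rw [map_mul]; ring
    rw [this]
    exact add_mem (mul_mem ⟨t, rfl⟩ ha) (mul_mem ⟨s, rfl⟩ hb)
  neg_mem' := by
    rintro a ⟨s, hs, ha⟩
    exact ⟨s, hs, by rw [mul_neg]; exact neg_mem ha⟩

variable {S K}

lemma range_le_locSubring : (algebraMap D K).range ≤ locSubring S K :=
  fun x hx ↦ ⟨1, one_mem S, by simpa using hx⟩

lemma locSubring_bot : locSubring (⊥ : Submonoid D) K = (algebraMap D K).range := by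
  refine le_antisymm ?_ range_le_locSubring
  rintro x ⟨s, hs, hx⟩
  rw [Submonoid.mem_bot.mp hs] at hx
  simpa using hx

/-- Finitely many elements of `D_S` have a common denominator in `S`. -/
lemma exists_common_denominator {ι : Type*} (I : Finset ι) (f : ι → K)
    (h : ∀ i ∈ I, f i ∈ locSubring S K) :
    ∃ s ∈ S, ∀ i ∈ I, algebraMap D K s * f i ∈ (algebraMap D K).range := by
  classical
  induction I using Finset.induction_on with
  | empty => exact ⟨1, one_mem S, by simp⟩
  | insert j I _ ih =>
    obtain ⟨s, hs, hsI⟩ := ih fun i hi ↦ h i (Finset.mem_insert_of_mem hi)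
    obtain ⟨t, ht, htj⟩ := h j (Finset.mem_insert_self j I)
    refine ⟨s * t, mul_mem hs ht, fun i hi ↦ ?_⟩
    rw [map_mul]
    rcases Finset.mem_insert.mp hi with rfl | hi
    · rw [mul_assoc]; exact mul_mem ⟨s, rfl⟩ htj
    · rw [mul_comm (algebraMap D K s), mul_assoc]; exact mul_mem ⟨t, rfl⟩ (hsI i hi)

/-- P`v`MDs are stable under rings of fractions: the inverse of a finitely generated fractional
ideal commutes with localization. -/
lemma IsPvMSubring.locSubring (h : IsPvMSubring (algebraMap D K).range) :
    IsPvMSubring (locSubring S K) := by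
  intro T hT
  obtain ⟨Y, hY, hY'⟩ := h T hT
  refine ⟨Y, fun y hy u hu ↦ range_le_locSubring (hY y hy u hu), fun x hx ↦ ?_⟩
  obtain ⟨s, hs, hsx⟩ := exists_common_denominator (S := S) (T ×ˢ Y)
    (fun p : K × K ↦ x * (p.1 * p.2)) fun p hp ↦
      hx _ (Finset.mem_product.mp hp).1 _ (Finset.mem_product.mp hp).2
  refine ⟨s, hs, hY' _ fun t ht y hy ↦ ?_⟩
  rw [mul_assoc]
  exact hsx (t, y) (Finset.mem_product.mpr ⟨ht, hy⟩)

/-- The conductor `{d | d x ∈ D}` of `x ∈ K` is an ideal of `D`. -/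
lemma exists_ideal_mem_iff_mul_mem_range (x : K) :
    ∃ I : Ideal D, ∀ d, d ∈ I ↔ algebraMap D K d * x ∈ (algebraMap D K).range := by
  refine ⟨Submodule.comap (LinearMap.toSpanSingleton D K x) (1 : Submodule D K), fun d ↦ ?_⟩
  rw [Submodule.mem_comap, LinearMap.toSpanSingleton_apply, Algebra.smul_def, Submodule.mem_one]
  rfl

/-- An element that lies in `D_P` for all maximal `P` lies in `D`: its conductor
`{d | d x ∈ D}` lies in no maximal ideal. -/
lemma mem_range_of_forall_mem_locSubring {x : K}
    (h : ∀ (M : Ideal D) [M.IsMaximal], x ∈ MultIdeal.locSubring M.primeCompl K) :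
    x ∈ (algebraMap D K).range := by
  obtain ⟨I, hI⟩ := exists_ideal_mem_iff_mul_mem_range (D := D) x
  by_cases hI1 : I = ⊤
  · have := (hI 1).mp (hI1 ▸ Submodule.mem_top)
    simpa using this
  · obtain ⟨M, hM, hIM⟩ := Ideal.exists_le_maximal I hI1
    obtain ⟨s, hs, hsx⟩ := h M
    exact absurd (hIM ((hI s).mpr hsx)) hs

/-- Being a `v`-domain is a local property in the direction from the localizations to `D`. -/
lemma isVSubring_of_forall_locSubring
    (h : ∀ (M : Ideal D) [M.IsMaximal], IsVSubring (MultIdeal.locSubring M.primeCompl K)) :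
    IsVSubring (algebraMap D K).range := by
  intro T hT x hx
  refine mem_range_of_forall_mem_locSubring fun M _ ↦ h M T hT x fun t ht y hy ↦ ?_
  obtain ⟨s, hs, hsy⟩ := exists_common_denominator T (fun u ↦ y * u) hy
  refine ⟨s, hs, ?_⟩
  have := hx t ht (algebraMap D K s * y) fun u hu ↦ by
    rw [mul_assoc]; exact hsy u hu
  convert this using 1
  ring

end Localization

section Domain

variable {D : Type*} [CommRing D] [IsDomain D] (S : Submonoid D) (hS : S ≤ D⁰)
  (K : Type*) [Field K] [Algebra D K] [IsFractionRing D K]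

include hS in
/-- `K` is a fraction field of `D_S`, in which `D_S` is the subring `locSubring S K`. -/
lemma exists_algebra_isFractionRing_localization :
    ∃ _ : Algebra (Localization S) K, IsFractionRing (Localization S) K ∧
      (algebraMap (Localization S) K).range = locSubring S K := by
  let _ := IsLocalization.localizationAlgebraOfSubmonoidLe (Localization S) K S D⁰ hS
  have := IsLocalization.localization_isScalarTower_of_submonoid_le (Localization S) K S D⁰ hS
  refine ⟨inferInstance,
    IsFractionRing.isFractionRing_of_isDomain_of_isLocalization S (Localization S) K, ?_⟩
  have hs0 (s : D) (hs : s ∈ S) : algebraMap D K s ≠ 0 := by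
    rw [Ne, FaithfulSMul.algebraMap_eq_zero_iff]
    exact nonZeroDivisors.ne_zero (hS hs)
  ext x
  constructor
  · rintro ⟨z, rfl⟩
    obtain ⟨a, s, rfl⟩ := IsLocalization.exists_mk'_eq S z
    refine ⟨s, s.2, a, ?_⟩
    rw [IsScalarTower.algebraMap_apply D (Localization S) K,
      IsScalarTower.algebraMap_apply D (Localization S) K, ← map_mul, IsLocalization.mk'_spec']
  · rintro ⟨s, hs, a, ha⟩
    refine ⟨IsLocalization.mk' _ a ⟨s, hs⟩, mul_left_cancel₀ (hs0 s hs) ?_⟩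
    rw [← ha, IsScalarTower.algebraMap_apply D (Localization S) K,
      IsScalarTower.algebraMap_apply D (Localization S) K, ← map_mul]
    exact congrArg _ (IsLocalization.mk'_spec' _ a ⟨s, hs⟩)

include hS in
lemma isVDomain_localization_iff [IsDomain (Localization S)] :
    IsVDomain (Localization S) ↔ IsVSubring (locSubring S K) := by
  obtain ⟨_, h, h'⟩ := exists_algebra_isFractionRing_localization S hS K
  rw [isVDomain_iff (Localization S) K, h']

include hS in
lemma isPvMD_localization_iff [IsDomain (Localization S)] :
    IsPvMD (Localization S) ↔ IsPvMSubring (locSubring S K) := by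
  obtain ⟨_, h, h'⟩ := exists_algebra_isFractionRing_localization S hS K
  rw [isPvMD_iff (Localization S) K, h']

end Domain

section TIdeals

variable {D : Type*} [CommRing D] (K : Type*) [Field K] [Algebra D K]

/-- An ideal `I` of `D` is `t`-proper if no finitely generated ideal `G ⊆ I` satisfies
`G⁻¹ ⊆ D`; for nonzero `I` this says that `I ^ t ≠ D`. The finite set `G` of generators is
taken inside `K`. -/
def IsTProper (I : Ideal D) : Prop :=
  ∀ G : Finset K, (∀ g ∈ G, ∃ d ∈ I, algebraMap D K d = g) →
    ∃ x, (∀ g ∈ G, x * g ∈ (algebraMap D K).range) ∧ x ∉ (algebraMap D K).range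

/-- A prime `P` is a valuation prime if `D_P` is a valuation ring of `K`. -/
def IsValuationPrime (P : Ideal D) [P.IsPrime] : Prop :=
  ∃ V : ValuationSubring K, ∀ x, x ∈ V ↔ x ∈ locSubring P.primeCompl K

variable {K}

/-- By Zorn's lemma, every `t`-proper ideal lies in a maximal one. -/
lemma IsTProper.exists_le_maximal {I : Ideal D} (hI : IsTProper K I) :
    ∃ P, I ≤ P ∧ Maximal (IsTProper K) P := by
  refine zorn_le_nonempty₀ {J : Ideal D | IsTProper K J} (fun c hc hcc J₀ hJ₀ ↦ ?_) I hI
  refine ⟨sSup c, fun G hG ↦ ?_, fun J hJ ↦ le_sSup hJ⟩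
  obtain ⟨J, hJ, hGJ⟩ : ∃ J ∈ c, ∀ g ∈ G, ∃ d ∈ J, algebraMap D K d = g := by
    classical
    induction G using Finset.induction_on with
    | empty => exact ⟨J₀, hJ₀, by simp⟩
    | insert g G _ ih =>
      obtain ⟨J₁, hJ₁, h₁⟩ := ih fun x hx ↦ hG x (Finset.mem_insert_of_mem hx)
      obtain ⟨d, hd, rfl⟩ := hG g (Finset.mem_insert_self g G)
      obtain ⟨J₂, hJ₂, h₂⟩ := (Submodule.mem_sSup_of_directed ⟨J₀, hJ₀⟩ hcc.directedOn).mp hd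
      obtain ⟨J, hJ, h₁', h₂'⟩ := hcc.directedOn J₁ hJ₁ J₂ hJ₂
      refine ⟨J, hJ, fun x hx ↦ ?_⟩
      rcases Finset.mem_insert.mp hx with rfl | hx
      · exact ⟨d, h₂' h₂, rfl⟩
      · obtain ⟨e, he, rfl⟩ := h₁ x hx
        exact ⟨e, h₁' he, rfl⟩
  exact hc hJ G hGJ

/-- Maximal `t`-proper ideals are prime: if `G₁ ⊆ P + (a)` and `G₂ ⊆ P + (b)` have inverse
`D`, then so does `G₁ G₂ ⊆ P + (a b)`. -/
lemma isPrime_of_maximal_isTProper {P : Ideal D} (hP : Maximal (IsTProper K) P) :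
    P.IsPrime := by
  classical
  refine ⟨?_, fun {a b} hab ↦ ?_⟩
  · rintro rfl
    obtain ⟨x, hx, hx'⟩ := hP.1 {1} fun g hg ↦
      ⟨1, Submodule.mem_top, by rw [Finset.mem_singleton.mp hg, map_one]⟩
    exact hx' (by simpa using hx)
  · by_contra! hn
    have key (c : D) (hc : c ∉ P) : ∃ G : Finset K,
        (∀ g ∈ G, ∃ d ∈ P ⊔ Ideal.span {c}, algebraMap D K d = g) ∧
        ∀ x, (∀ g ∈ G, x * g ∈ (algebraMap D K).range) → x ∈ (algebraMap D K).range := by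
      have : ¬ IsTProper K (P ⊔ Ideal.span {c}) := fun h ↦
        hc (hP.2 h le_sup_left
          (Ideal.mem_sup_right (Ideal.mem_span_singleton_self c)))
      rw [IsTProper] at this
      push Not at this
      exact this
    obtain ⟨G₁, h₁, h₁'⟩ := key a hn.1
    obtain ⟨G₂, h₂, h₂'⟩ := key b hn.2
    obtain ⟨x, hx, hx'⟩ := hP.1 (Finset.image₂ (· * ·) G₁ G₂) fun g hg ↦ by
      obtain ⟨g₁, hg₁, g₂, hg₂, rfl⟩ := Finset.mem_image₂.mp hg
      obtain ⟨d₁, hd₁, rfl⟩ := h₁ g₁ hg₁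
      obtain ⟨d₂, hd₂, rfl⟩ := h₂ g₂ hg₂
      refine ⟨d₁ * d₂, ?_, map_mul _ _ _⟩
      obtain ⟨p₁, hp₁, r₁, hr₁, rfl⟩ := Submodule.mem_sup.mp hd₁
      obtain ⟨p₂, hp₂, r₂, hr₂, rfl⟩ := Submodule.mem_sup.mp hd₂
      obtain ⟨r₁, rfl⟩ := Ideal.mem_span_singleton'.mp hr₁
      obtain ⟨r₂, rfl⟩ := Ideal.mem_span_singleton'.mp hr₂
      have : (p₁ + r₁ * a) * (p₂ + r₂ * b) =
        p₁ * (p₂ + r₂ * b) + r₁ * a * p₂ + r₁ * r₂ * (a * b) := by ring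
      rw [this]
      exact P.add_mem (P.add_mem (P.mul_mem_right _ hp₁) (P.mul_mem_left _ hp₂))
        (P.mul_mem_left _ hab)
    refine hx' (h₁' x fun g₁ hg₁ ↦ h₂' _ fun g₂ hg₂ ↦ ?_)
    rw [mul_assoc]
    exact hx _ (Finset.mem_image₂.mpr ⟨g₁, hg₁, g₂, hg₂, rfl⟩)

/-- The conductor ideal `{d | d x ∈ D}` of an element `x ∉ D` is `t`-proper, so that a maximal
`t`-proper ideal containing it detects that `x ∉ D`. -/
lemma exists_maximal_isTProper_of_notMem_range {x : K} (hx : x ∉ (algebraMap D K).range) :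
    ∃ P : Ideal D, Maximal (IsTProper K) P ∧
      ∀ d, algebraMap D K d * x ∈ (algebraMap D K).range → d ∈ P := by
  obtain ⟨I, hI⟩ := exists_ideal_mem_iff_mul_mem_range (D := D) x
  have hIt : IsTProper K I := fun G hG ↦ ⟨x, fun g hg ↦ by
    obtain ⟨d, hd, rfl⟩ := hG g hg
    rw [mul_comm]
    exact (hI d).mp hd, hx⟩
  obtain ⟨P, hIP, hP⟩ := hIt.exists_le_maximal
  exact ⟨P, hP, fun d hd ↦ hIP ((hI d).mpr hd)⟩

/-- A finite set `T` becomes principal over the valuation ring `D_P`: it is generated by an element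
`t` of largest value. Consequently `s / t ∈ F⁻¹` for some `s ∉ P`, where `F` is generated
by `T`, and `F F⁻¹ ⊄ P`. -/
lemma IsValuationPrime.exists_forall_div_mul_mem {P : Ideal D} [P.IsPrime]
    (hP : IsValuationPrime K P) {T : Finset K} (hT : ∃ t ∈ T, t ≠ 0) :
    ∃ t ∈ T, t ≠ 0 ∧ ∃ s ∉ P, ∀ u ∈ T, algebraMap D K s / t * u ∈ (algebraMap D K).range := by
  obtain ⟨V, hV⟩ := hP
  obtain ⟨t₀, ht₀, ht₀'⟩ := hT
  obtain ⟨t, ht, hmax⟩ := Finset.exists_max_image T V.valuation ⟨t₀, ht₀⟩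
  have h0 : t ≠ 0 := by
    rintro rfl
    have := hmax t₀ ht₀
    rw [map_zero, le_zero_iff, map_eq_zero] at this
    exact ht₀' this
  have hmem : ∀ u ∈ T, u / t ∈ locSubring P.primeCompl K := fun u hu ↦ by
    rw [← hV, ← V.valuation_le_one_iff, map_div₀]
    exact div_le_one_of_le₀ (hmax u hu) zero_le
  obtain ⟨s, hs, h⟩ := exists_common_denominator T (fun u ↦ u / t) hmem
  refine ⟨t, ht, h0, s, hs, fun u hu ↦ ?_⟩
  rw [div_mul_eq_mul_div, mul_div_assoc]
  exact h u hu

/-- If the ideals `(z, 1)` are `t`-invertible then the localizations at the maximal `t`-proper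
ideals are valuation rings. -/
lemma isValuationPrime_of_maximal_isTProper {P : Ideal D} [P.IsPrime]
    (hP : Maximal (IsTProper K) P) [FaithfulSMul D K]
    (h : ∀ z : K, z ≠ 0 → ∃ Y : Finset K,
      (∀ y ∈ Y, y ∈ (algebraMap D K).range ∧ y * z ∈ (algebraMap D K).range) ∧
      ∀ x, (∀ y ∈ Y, x * y ∈ (algebraMap D K).range ∧ x * (z * y) ∈ (algebraMap D K).range) →
        x ∈ (algebraMap D K).range) :
    IsValuationPrime K P := by
  classical
  refine ⟨⟨locSubring P.primeCompl K, fun z ↦ ?_⟩, fun x ↦ Iff.rfl⟩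
  by_cases hz : z = 0
  · left; rw [hz]; exact zero_mem (locSubring P.primeCompl K)
  obtain ⟨Y, hY, hY'⟩ := h z hz
  -- Some generator `y` or `z y` of `(z, 1) Y` lies outside `P`, as `P` is `t`-proper.
  have : ∃ y ∈ Y, (∃ s ∉ P, algebraMap D K s = y) ∨ ∃ s ∉ P, algebraMap D K s = z * y := by
    by_contra! hn
    obtain ⟨x, hx, hx'⟩ := hP.1 (Y ∪ Y.image (z * ·)) fun g hg ↦ by
      rcases Finset.mem_union.mp hg with hg | hg
      · obtain ⟨d, hd⟩ := (hY g hg).1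
        exact ⟨d, by_contra fun hdP ↦ (hn g hg).1 d hdP hd, hd⟩
      · obtain ⟨y, hy, rfl⟩ := Finset.mem_image.mp hg
        obtain ⟨d, hd⟩ := (hY y hy).2
        rw [mul_comm] at hd
        exact ⟨d, by_contra fun hdP ↦ (hn y hy).2 d hdP hd, hd⟩
    exact hx' (hY' x fun y hy ↦ ⟨hx _ (Finset.mem_union_left _ hy),
      hx _ (Finset.mem_union_right _ (Finset.mem_image_of_mem _ hy))⟩)
  obtain ⟨y, hy, ⟨s, hs, hsy⟩ | ⟨s, hs, hsy⟩⟩ := this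
  · left
    exact ⟨s, hs, hsy ▸ (hY y hy).2⟩
  · right
    refine ⟨s, hs, ?_⟩
    rw [hsy, mul_right_comm, mul_inv_cancel₀ hz, one_mul]
    exact (hY y hy).1

lemma IsPvMSubring.isValuationPrime (h : IsPvMSubring (algebraMap D K).range)
    [FaithfulSMul D K] {P : Ideal D} [P.IsPrime] (hP : Maximal (IsTProper K) P) :
    IsValuationPrime K P := by
  classical
  refine isValuationPrime_of_maximal_isTProper hP fun z hz ↦ ?_
  obtain ⟨Y, hY, hY'⟩ := h {z, 1} ⟨z, by simp, hz⟩
  refine ⟨Y, fun y hy ↦ ⟨by simpa using hY y hy 1 (by simp), hY y hy z (by simp)⟩, fun x hx ↦ ?_⟩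
  refine hY' x fun t ht y hy ↦ ?_
  rcases Finset.mem_insert.mp ht with rfl | ht
  · exact (hx y hy).2
  · rw [Finset.mem_singleton.mp ht, one_mul]
    exact (hx y hy).1

/-- Griffin's criterion: if `D_P` is a valuation ring for all maximal `t`-proper ideals `P`,
then `D` is a P`v`MD. Otherwise `F F⁻¹` would be `t`-proper for some finitely generated
`F`, hence contained in some such `P`, over which `F` is principal. -/
lemma isPvMSubring_of_forall_isValuationPrime
    (h : ∀ (P : Ideal D) [P.IsPrime], Maximal (IsTProper K) P → IsValuationPrime K P) :
    IsPvMSubring (algebraMap D K).range := by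
  classical
  intro T hT
  let I : Ideal D := Ideal.span {d | ∃ t ∈ T, ∃ y,
    (∀ u ∈ T, y * u ∈ (algebraMap D K).range) ∧ algebraMap D K d = t * y}
  have hI : ¬ IsTProper K I := fun hI ↦ by
    obtain ⟨P, hIP, hP⟩ := hI.exists_le_maximal
    have := isPrime_of_maximal_isTProper hP
    obtain ⟨t, ht, ht0, s, hs, hsT⟩ := (h P hP).exists_forall_div_mul_mem hT
    exact hs (hIP (Ideal.subset_span ⟨t, ht, _, hsT, (mul_div_cancel₀ _ ht0).symm⟩))
  rw [IsTProper] at hI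
  push Not at hI
  obtain ⟨G, hG, hG'⟩ := hI
  obtain ⟨Y, hY, hY'⟩ := exists_finset_forall_mul_mem (algebraMap D K).range T G
    (fun y ↦ ∀ u ∈ T, y * u ∈ (algebraMap D K).range) fun g hg ↦ by
      obtain ⟨d, hd, rfl⟩ := hG g hg
      clear hg
      induction hd using Submodule.span_induction with
      | mem d hd =>
        obtain ⟨t, ht, y, hy, hd⟩ := hd
        exact ⟨{y}, by simpa using hy, fun x hx ↦ hd ▸ hx t ht y (Finset.mem_singleton_self y)⟩
      | zero => exact ⟨∅, by simp, fun x _ ↦ by simp⟩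
      | add a b _ _ ha hb =>
        obtain ⟨Y₁, h₁, h₁'⟩ := ha
        obtain ⟨Y₂, h₂, h₂'⟩ := hb
        refine ⟨Y₁ ∪ Y₂, fun y hy ↦ (Finset.mem_union.mp hy).elim (h₁ y) (h₂ y),
          fun x hx ↦ ?_⟩
        rw [map_add, mul_add]
        exact add_mem (h₁' x fun t ht y hy ↦ hx t ht y (Finset.mem_union_left _ hy))
          (h₂' x fun t ht y hy ↦ hx t ht y (Finset.mem_union_right _ hy))
      | smul r a _ ha =>
        obtain ⟨Y, h, h'⟩ := ha
        refine ⟨Y, h, fun x hx ↦ ?_⟩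
        rw [smul_eq_mul, map_mul, mul_left_comm]
        exact mul_mem ⟨r, rfl⟩ (h' x hx)
  exact ⟨Y, hY, fun x hx ↦ hG' x (hY' x hx)⟩

end TIdeals

/-! ### Essential domains, `v`-domains and P`v`MDs -/

section CommRing

variable {D : Type*} [CommRing D]

lemma mem_locSubring_primeCompl_iff {P : Ideal D} [P.IsPrime] {K : Type*} [Field K]
    [Algebra D K] [FaithfulSMul D K] {x : K} :
    x ∈ locSubring P.primeCompl K ↔
      ∃ a s : D, s ∉ P ∧ x = algebraMap D K a / algebraMap D K s := by
  have h0 (s : D) (hs : s ∉ P) : algebraMap D K s ≠ 0 := by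
    rw [Ne, FaithfulSMul.algebraMap_eq_zero_iff]
    rintro rfl
    exact hs P.zero_mem
  constructor
  · rintro ⟨s, hs, a, ha⟩
    exact ⟨a, s, hs, by rw [ha, mul_div_cancel_left₀ _ (h0 s hs)]⟩
  · rintro ⟨a, s, hs, rfl⟩
    exact ⟨s, hs, a, (mul_div_cancel₀ _ (h0 s hs)).symm⟩

/-- Elements of `P` are nonunits of `D_P`. -/
lemma algebraMap_mul_ne_one_of_mem {K : Type*} [Field K] [Algebra D K] [IsFractionRing D K]
    {P : Ideal D} [P.IsPrime] {p : D} (hp : p ∈ P) {w : K}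
    (hw : w ∈ locSubring P.primeCompl K) : algebraMap D K p * w ≠ 1 := by
  rintro h
  obtain ⟨s, hs, a, ha⟩ := hw
  refine hs ?_
  have : s = p * a := by
    refine IsFractionRing.injective D K ?_
    rw [map_mul, ha, mul_left_comm, h, mul_one]
  rw [this]
  exact P.mul_mem_right _ hp

end CommRing

section Implications

variable {D : Type*} [CommRing D] [IsDomain D]

/-- A P`v`MD is already the intersection of its localizations at the maximal `t`-proper ideals,
which are valuation rings. -/
theorem IsPvMD.isEssentialDomain (h : IsPvMD D) : IsEssentialDomain D := by
  rw [isPvMD_iff D (FractionRing D)] at h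
  refine ⟨{V | ∃ (P : Ideal D) (_ : P.IsPrime),
    ∀ x, x ∈ V ↔ x ∈ locSubring P.primeCompl (FractionRing D)}, ?_, fun x ↦ ⟨fun hx ↦ ?_, ?_⟩⟩
  · rintro V ⟨P, hP, hV⟩
    exact ⟨P, hP, fun x ↦ (hV x).trans mem_locSubring_primeCompl_iff⟩
  · by_contra hxD
    obtain ⟨P, hP, hxP⟩ := exists_maximal_isTProper_of_notMem_range hxD
    have := isPrime_of_maximal_isTProper hP
    obtain ⟨V, hV⟩ := h.isValuationPrime hP
    obtain ⟨s, hs, hsx⟩ := (hV x).mp (hx V ⟨P, this, hV⟩)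
    exact hs (hxP s hsx)
  · rintro hx V ⟨P, _, hV⟩
    exact (hV x).mpr (range_le_locSubring hx)

theorem IsEssentialDomain.isVDomain (h : IsEssentialDomain D) : IsVDomain D := by
  rw [isVDomain_iff D (FractionRing D)]
  obtain ⟨S, hS, h⟩ := h
  intro T hT x hx
  refine (h x).mp fun V hV ↦ ?_
  obtain ⟨P, hP, hVP⟩ := hS V hV
  have hVP' (z) : z ∈ V ↔ z ∈ locSubring P.primeCompl (FractionRing D) :=
    (hVP z).trans mem_locSubring_primeCompl_iff.symm
  obtain ⟨t, ht, ht0, s, hs, hsT⟩ :=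
    IsValuationPrime.exists_forall_div_mul_mem (P := P) ⟨V, hVP'⟩ hT
  refine (hVP' x).mpr ⟨s, hs, ?_⟩
  have := hx t ht _ hsT
  rwa [mul_div_cancel₀ _ ht0, mul_comm] at this

theorem IsPvMD.isVDomain (h : IsPvMD D) : IsVDomain D :=
  (isVDomain_iff D (FractionRing D)).mpr ((isPvMD_iff D (FractionRing D)).mp h).isVSubring

theorem IsPvMD.localization (h : IsPvMD D) (S : Submonoid D) (hS : S ≤ D⁰)
    [IsDomain (Localization S)] : IsPvMD (Localization S) :=
  (isPvMD_localization_iff S hS (FractionRing D)).mpr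
    ((isPvMD_iff D (FractionRing D)).mp h).locSubring

theorem IsPvMD.isPDomain (h : IsPvMD D) : IsPDomain D := by
  intro S hS
  have := IsLocalization.isDomain_localization hS
  exact (h.localization S hS).isEssentialDomain

theorem IsPvMD.isLocallyPvMD (h : IsPvMD D) : IsLocallyPvMD D :=
  fun P _ ↦ h.localization P.primeCompl P.primeCompl_le_nonZeroDivisors

theorem IsLocallyPvMD.isLocallyVDomain (h : IsLocallyPvMD D) : IsLocallyVDomain D :=
  fun P _ ↦ (h P).isVDomain

/-- The trivial ring of fractions `D_{1}` is `D` itself. -/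
theorem IsPDomain.isVDomain (h : IsPDomain D) : IsVDomain D := by
  have := IsLocalization.isDomain_localization (bot_le : (⊥ : Submonoid D) ≤ D⁰)
  have hv := (h ⊥ bot_le).isVDomain
  rwa [isVDomain_localization_iff ⊥ bot_le (FractionRing D), locSubring_bot,
    ← isVDomain_iff] at hv

theorem IsLocallyVDomain.isVDomain (h : IsLocallyVDomain D) : IsVDomain D := by
  rw [isVDomain_iff D (FractionRing D)]
  refine isVSubring_of_forall_locSubring fun M _ ↦ ?_
  rw [← isVDomain_localization_iff M.primeCompl M.primeCompl_le_nonZeroDivisors]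
  exact h M

lemma span_singleton_inf_span_singleton_ne_bot {a b : D} (ha : a ≠ 0) (hb : b ≠ 0) :
    (Ideal.span {a} ⊓ Ideal.span {b} : Ideal D) ≠ ⊥ :=
  (Submodule.ne_bot_iff _).mpr ⟨a * b,
    ⟨Ideal.mul_mem_right _ _ (Ideal.mem_span_singleton_self a),
      Ideal.mul_mem_left _ _ (Ideal.mem_span_singleton_self b)⟩, mul_ne_zero ha hb⟩

/-- In a `v`-finite conductor domain, `(a D ∩ b D)⁻¹ = F⁻¹` for the fractional ideal `F`
generated by some finite `T ⊆ a D ∩ b D`. -/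
lemma IsVFiniteConductorDomain.exists_finset (h : IsVFiniteConductorDomain D) {a b : D}
    (ha : a ≠ 0) (hb : b ≠ 0) :
    ∃ T : Finset (FractionRing D),
      (∀ t ∈ T, t / algebraMap D _ a ∈ (algebraMap D (FractionRing D)).range ∧
        t / algebraMap D _ b ∈ (algebraMap D (FractionRing D)).range) ∧
      ∀ x, (∀ t ∈ T, x * t ∈ (algebraMap D (FractionRing D)).range) →
        ∀ z, z / algebraMap D _ a ∈ (algebraMap D (FractionRing D)).range →
          z / algebraMap D _ b ∈ (algebraMap D (FractionRing D)).range →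
          x * z ∈ (algebraMap D (FractionRing D)).range := by
  obtain ⟨F, hF, hFA⟩ := h a b ha hb
  set I : Ideal D := Ideal.span {a} ⊓ Ideal.span {b}
  have hI0 : (I : FractionalIdeal D⁰ (FractionRing D)) ≠ 0 :=
    FractionalIdeal.coeIdeal_ne_zero.mpr (span_singleton_inf_span_singleton_ne_bot ha hb)
  have ha0 : algebraMap D (FractionRing D) a ≠ 0 := by
    rwa [Ne, FaithfulSMul.algebraMap_eq_zero_iff]
  have hb0 : algebraMap D (FractionRing D) b ≠ 0 := by
    rwa [Ne, FaithfulSMul.algebraMap_eq_zero_iff]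
  have hinv : F⁻¹ = (I : FractionalIdeal D⁰ (FractionRing D))⁻¹ := by
    rw [← inv_vClosure hF.1, hFA, inv_vClosure hI0]
  -- `I ^ v ⊆ c D` as soon as `I ⊆ c D`.
  have key (c : D) (hc0 : algebraMap D (FractionRing D) c ≠ 0) (hc : I ≤ Ideal.span {c})
      (t : FractionRing D) (ht : t ∈ F) :
      t / algebraMap D _ c ∈ (algebraMap D (FractionRing D)).range := by
    have ht : t ∈ vClosure (I : FractionalIdeal D⁰ (FractionRing D)) :=
      hFA ▸ le_vClosure hF.1 ht
    rw [vClosure, FractionalIdeal.mem_inv_iff (inv_ne_zero_of_ne_zero hI0)] at ht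
    rw [div_eq_mul_inv, ← mem_one_iff_mem_range]
    refine ht _ ((FractionalIdeal.mem_inv_iff hI0).mpr fun z hz ↦ ?_)
    obtain ⟨d, hd, rfl⟩ := (FractionalIdeal.mem_coeIdeal _).mp hz
    obtain ⟨e, rfl⟩ := Ideal.mem_span_singleton'.mp (hc hd)
    rw [mem_one_iff_mem_range]
    exact ⟨e, by rw [map_mul]; field_simp⟩
  obtain ⟨T, -, hT⟩ := isFG_iff_exists_span.mp hF
  refine ⟨T, fun t ht ↦ ?_, fun x hx z hza hzb ↦ ?_⟩
  · have htF : t ∈ F := by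
      rw [← FractionalIdeal.mem_coe, hT]
      exact Submodule.subset_span ht
    exact ⟨key a ha0 inf_le_left t htF, key b hb0 inf_le_right t htF⟩
  · have hx : x ∈ F⁻¹ := (mem_inv_iff_of_coe_eq_span hF.1 hT).mpr hx
    rw [hinv, FractionalIdeal.mem_inv_iff hI0] at hx
    rw [← mem_one_iff_mem_range]
    refine hx z ?_
    obtain ⟨c, hc⟩ := hza
    obtain ⟨d, hd⟩ := hzb
    rw [eq_div_iff ha0, ← map_mul] at hc
    rw [eq_div_iff hb0, ← map_mul] at hd
    refine (FractionalIdeal.mem_coeIdeal _).mpr ⟨c * a, ⟨?_, ?_⟩, hc⟩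
    · exact Ideal.mul_mem_left _ _ (Ideal.mem_span_singleton_self a)
    · rw [IsFractionRing.injective D (FractionRing D) (hc.trans hd.symm)]
      exact Ideal.mul_mem_left _ _ (Ideal.mem_span_singleton_self b)

/-- For `z = a / b` the inverse of `(z, 1)` is `a⁻¹ (a D ∩ b D)`, which is `v`-finite in a
`v`-finite conductor domain. In a `v`-domain this makes `(z, 1)` a `t`-invertible ideal, so that
`D_P` is a valuation ring for each maximal `t`-proper ideal `P`. -/
theorem IsVDomain.isPvMD (hv : IsVDomain D) (h : IsVFiniteConductorDomain D) : IsPvMD D := by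
  classical
  rw [isVDomain_iff D (FractionRing D)] at hv
  rw [isPvMD_iff D (FractionRing D)]
  refine isPvMSubring_of_forall_isValuationPrime fun P _ hP ↦
    isValuationPrime_of_maximal_isTProper hP fun z hz ↦ ?_
  obtain ⟨a, b, hb, rfl⟩ := IsFractionRing.div_surjective (A := D) z
  have hb0 : algebraMap D (FractionRing D) b ≠ 0 := by
    rintro h0; simp [h0] at hz
  have ha0 : algebraMap D (FractionRing D) a ≠ 0 := by
    rintro h0; simp [h0] at hz
  obtain ⟨T, hT, hT'⟩ := h.exists_finset (a := a) (b := b) (by rintro rfl; simp at ha0)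
    (nonZeroDivisors.ne_zero hb)
  refine ⟨T.image (· / algebraMap D _ a), fun y hy ↦ ?_, fun x hx ↦ ?_⟩
  · obtain ⟨t, ht, rfl⟩ := Finset.mem_image.mp hy
    refine ⟨(hT t ht).1, ?_⟩
    convert (hT t ht).2 using 1
    field_simp
  · refine hv {algebraMap D _ a / algebraMap D _ b, 1} ⟨1, by simp, one_ne_zero⟩ x
      fun t ht y hy ↦ ?_
    have hy1 : y ∈ (algebraMap D (FractionRing D)).range := by simpa using hy 1 (by simp)
    have hy2 := hy (algebraMap D _ a / algebraMap D _ b) (by simp)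
    have hya : y * algebraMap D _ a / algebraMap D _ a ∈ (algebraMap D (FractionRing D)).range := by
      rwa [mul_div_cancel_right₀ _ ha0]
    have hyb : y * algebraMap D _ a / algebraMap D _ b ∈ (algebraMap D (FractionRing D)).range := by
      rwa [mul_div_assoc]
    rcases Finset.mem_insert.mp ht with rfl | ht
    · convert hT' (x / algebraMap D _ b) (fun t ht ↦ ?_) _ hya hyb using 1
      · field_simp
      · convert (hx _ (Finset.mem_image_of_mem _ ht)).2 using 1
        field_simp
    · rw [Finset.mem_singleton.mp ht, one_mul]
      convert hT' (x / algebraMap D _ a) (fun t ht ↦ ?_) _ hya hyb using 1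
      · field_simp
      · convert (hx _ (Finset.mem_image_of_mem _ ht)).1 using 1
        field_simp

theorem tfae_of_isVFiniteConductorDomain (h : IsVFiniteConductorDomain D) :
    [IsPvMD D, IsLocallyPvMD D, IsPDomain D, IsEssentialDomain D, IsLocallyVDomain D,
      IsVDomain D].TFAE := by
  tfae_have 1 → 2 := IsPvMD.isLocallyPvMD
  tfae_have 1 → 3 := IsPvMD.isPDomain
  tfae_have 1 → 4 := IsPvMD.isEssentialDomain
  tfae_have 2 → 5 := IsLocallyPvMD.isLocallyVDomain
  tfae_have 5 → 6 := IsLocallyVDomain.isVDomain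
  tfae_have 3 → 6 := IsPDomain.isVDomain
  tfae_have 4 → 6 := IsEssentialDomain.isVDomain
  tfae_have 6 → 1 := fun hv ↦ hv.isPvMD h
  tfae_finish

end Implications

/-! ### Noetherian domains -/

section Noetherian

variable {D : Type*} [CommRing D] [IsDomain D]

theorem isVFiniteConductorDomain_of_isNoetherianRing [IsNoetherianRing D] :
    IsVFiniteConductorDomain D := by
  intro a b ha hb
  refine ⟨_, ⟨?_, ?_⟩, rfl⟩
  · exact FractionalIdeal.coeIdeal_ne_zero.mpr (span_singleton_inf_span_singleton_ne_bot ha hb)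
  · exact isNoetherian_submodule.mp (FractionalIdeal.isNoetherian _) _ le_rfl

/-- If `x` is integral over `D`, then `F = D[x]` is finitely generated and `x F ⊆ F`, whence
`x ∈ (F F⁻¹)⁻¹`. -/
theorem IsVDomain.isIntegrallyClosed (h : IsVDomain D) : IsIntegrallyClosed D := by
  rw [isVDomain_iff D (FractionRing D)] at h
  rw [isIntegrallyClosed_iff (FractionRing D)]
  intro x hx
  obtain ⟨T, hT⟩ := hx.fg_adjoin_singleton
  have hTF {y : FractionRing D} (hy : ∀ u ∈ T, y * u ∈ (algebraMap D (FractionRing D)).range)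
      {f : FractionRing D} (hf : f ∈ Algebra.adjoin D {x}) :
      y * f ∈ (algebraMap D (FractionRing D)).range := by
    rw [← Subalgebra.mem_toSubmodule, ← hT] at hf
    induction hf using Submodule.span_induction with
    | mem t ht => exact hy t ht
    | zero => simp
    | add a b _ _ ha hb => rw [mul_add]; exact add_mem ha hb
    | smul d a _ ha =>
      rw [Algebra.smul_def, mul_left_comm]
      exact mul_mem ⟨d, rfl⟩ ha
  refine h T ?_ x fun t ht y hy ↦ ?_
  · by_contra! h0
    have h1 : (1 : FractionRing D) ∈ Submodule.span D (T : Set (FractionRing D)) := by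
      rw [hT]; exact one_mem (Algebra.adjoin D {x})
    rw [Submodule.span_eq_bot.mpr h0, Submodule.mem_bot] at h1
    exact one_ne_zero h1
  · rw [← mul_assoc, mul_comm]
    refine hTF hy (mul_mem (Algebra.self_mem_adjoin_singleton D x) ?_)
    rw [← Subalgebra.mem_toSubmodule, ← hT]
    exact Submodule.subset_span ht

/-- If `x F F⁻¹ ⊆ D` then `x F⁻¹ ⊆ F⁻¹`, hence `xⁿ F⁻¹ ⊆ F⁻¹` for all `n`, so that
`x` is almost integral over `D`. -/
theorem IsCICDomain.isVDomain (h : IsCICDomain D) : IsVDomain D := by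
  rw [isVDomain_iff D (FractionRing D)]
  intro T ⟨t, ht, ht0⟩ x hx
  obtain ⟨⟨d, hd⟩, hdT⟩ := IsLocalization.exist_integer_multiples_of_finset D⁰ T
  have hpow (n : ℕ) (u) (hu : u ∈ T) :
      x ^ n * algebraMap D _ d * u ∈ (algebraMap D (FractionRing D)).range := by
    induction n generalizing u with
    | zero =>
      rw [pow_zero, one_mul, ← Algebra.smul_def]
      exact hdT u hu
    | succ n ih =>
      convert hx u hu _ ih using 1
      ring
  have hmem : x ∈ completeIntegralClosure D (FractionRing D) := by
    obtain ⟨r, hr⟩ := hpow 0 t ht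
    refine ⟨r, mem_nonZeroDivisors_of_ne_zero ?_, fun n ↦ ?_⟩
    · rintro rfl
      rw [map_zero, pow_zero, one_mul, zero_eq_mul,
        FaithfulSMul.algebraMap_eq_zero_iff] at hr
      exact hr.elim (nonZeroDivisors.ne_zero hd) ht0
    · rw [Algebra.smul_def, hr]
      convert hpow n t ht using 1
      ring
  rw [h] at hmem
  exact Algebra.mem_bot.mp hmem

theorem isCICDomain_of_isIntegrallyClosed [IsNoetherianRing D] [IsIntegrallyClosed D] :
    IsCICDomain D := by
  rw [IsCICDomain, completeIntegralClosure_eq_integralClosure]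
  exact IsIntegrallyClosed.integralClosure_eq_bot D _

/-- Discrete valuation rings are completely integrally closed, and this property is inherited by
intersections. -/
theorem IsKrullDomain.isCICDomain (h : IsKrullDomain D) : IsCICDomain D := by
  obtain ⟨S, hS, hD, -⟩ := h
  refine le_bot_iff.mp ?_
  rintro z ⟨r, hr, hz⟩
  refine Algebra.mem_bot.mpr ((hD z).mp fun V hV ↦ ?_)
  have := hS V hV
  have hrV : algebraMap D (FractionRing D) r ∈ V := (hD _).mpr ⟨r, rfl⟩ V hV
  have hzV : IsAlmostIntegral V z := by
    refine ⟨⟨_, hrV⟩, mem_nonZeroDivisors_of_ne_zero fun h0 ↦ ?_, fun n ↦ ?_⟩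
    · have := congrArg Subtype.val h0
      exact nonZeroDivisors.ne_zero hr (by simpa using this)
    · refine ⟨⟨r • z ^ n, (hD _).mpr (hz n) V hV⟩, ?_⟩
      change r • z ^ n = algebraMap D (FractionRing D) r * z ^ n
      rw [Algebra.smul_def]
  obtain ⟨v, rfl⟩ := IsIntegrallyClosed.isIntegral_iff.mp hzV.isIntegral
  exact v.2

/-- Localizations of a Noetherian domain at nonzero valuation primes are discrete. -/
lemma isDiscreteValuationRing_of_mem_iff [IsNoetherianRing D] {P : Ideal D} [P.IsPrime]
    (hP : P ≠ ⊥) (V : ValuationSubring (FractionRing D))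
    (hV : ∀ x, x ∈ V ↔ x ∈ locSubring P.primeCompl (FractionRing D)) :
    IsDiscreteValuationRing V := by
  have hnoeth : IsNoetherianRing V := by
    obtain ⟨_, _, hr⟩ := exists_algebra_isFractionRing_localization P.primeCompl
      P.primeCompl_le_nonZeroDivisors (FractionRing D)
    have : IsNoetherianRing (Localization P.primeCompl) :=
      IsLocalization.isNoetherianRing P.primeCompl _ inferInstance
    refine isNoetherianRing_of_surjective (Localization P.primeCompl) V
      ((algebraMap (Localization P.primeCompl) (FractionRing D)).codRestrict V.toSubring
        fun z ↦ (hV _).mpr (hr ▸ ⟨z, rfl⟩)) fun v ↦ ?_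
    obtain ⟨z, hz⟩ := hr.ge ((hV v).mp v.2)
    exact ⟨z, Subtype.ext hz⟩
  have hfield : ¬ IsField V := fun hf ↦ by
    obtain ⟨p, hp, hp0⟩ := Submodule.exists_mem_ne_zero_of_ne_bot hP
    have hp0' : algebraMap D (FractionRing D) p ≠ 0 := by
      rwa [Ne, FaithfulSMul.algebraMap_eq_zero_iff]
    obtain ⟨w, hw⟩ := hf.mul_inv_cancel
      (a := ⟨algebraMap D _ p, (hV _).mpr (range_le_locSubring ⟨p, rfl⟩)⟩)
      fun h ↦ hp0' (congrArg Subtype.val h)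
    exact algebraMap_mul_ne_one_of_mem hp ((hV w).mp w.2) (congrArg Subtype.val hw)
  have h : IsDiscreteValuationRing V ↔ ValuationRing V :=
    (IsDiscreteValuationRing.TFAE V hfield).out 0 1
  exact h.mpr inferInstance

lemma exists_dvd_pow_of_not_isUnit {R : Type*} [CommRing R] [IsDomain R]
    [IsDiscreteValuationRing R] {x p : R} (hx : x ≠ 0) (hp : ¬ IsUnit p) : ∃ n, x ∣ p ^ n := by
  obtain ⟨ϖ, hϖ⟩ := IsDiscreteValuationRing.exists_irreducible R
  obtain ⟨n, hn⟩ := IsDiscreteValuationRing.associated_pow_irreducible hx hϖ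
  have hpm : p ∈ IsLocalRing.maximalIdeal R := hp
  rw [hϖ.maximalIdeal_eq, Ideal.mem_span_singleton] at hpm
  exact ⟨n, hn.dvd.trans (pow_dvd_pow_of_dvd hpm n)⟩

/-- If `D_P` is a discrete valuation ring, then `P` is minimal over each of its nonzero elements. -/
lemma mem_minimalPrimes_of_isDiscreteValuationRing {P : Ideal D} [hP : P.IsPrime]
    (V : ValuationSubring (FractionRing D)) [IsDiscreteValuationRing V]
    (hV : ∀ x, x ∈ V ↔ x ∈ locSubring P.primeCompl (FractionRing D))
    {x : D} (hx0 : x ≠ 0) (hx : x ∈ P) : P ∈ (Ideal.span {x}).minimalPrimes := by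
  have hmem (d : D) : algebraMap D (FractionRing D) d ∈ V :=
    (hV _).mpr (range_le_locSubring ⟨d, rfl⟩)
  refine ⟨⟨hP, (Ideal.span_singleton_le_iff_mem P).mpr hx⟩, fun Q ⟨hQ, hxQ⟩ hQP p hp ↦ ?_⟩
  have hpu : ¬ IsUnit (⟨_, hmem p⟩ : V) := fun hu ↦ by
    obtain ⟨w, hw⟩ := hu.exists_right_inv
    exact algebraMap_mul_ne_one_of_mem hp ((hV w).mp w.2) (congrArg Subtype.val hw)
  obtain ⟨n, w, hw⟩ := exists_dvd_pow_of_not_isUnit (x := (⟨_, hmem x⟩ : V))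
    (fun h ↦ hx0 (by simpa using congrArg Subtype.val h)) hpu
  obtain ⟨s, hs, a, ha⟩ := (hV w).mp w.2
  have hw : algebraMap D (FractionRing D) p ^ n = algebraMap D _ x * w :=
    congrArg Subtype.val hw
  have heq : s * p ^ n = x * a := by
    refine IsFractionRing.injective D (FractionRing D) ?_
    rw [map_mul, map_mul, map_pow, ha, hw, mul_left_comm]
  have hsQ : s * p ^ n ∈ Q := by
    rw [heq]
    exact Q.mul_mem_right _ (hxQ (Ideal.mem_span_singleton_self x))
  exact hQ.mem_of_pow_mem n ((hQ.mem_or_mem hsQ).resolve_left fun h ↦ hs (hQP h))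

/-- A Noetherian P`v`MD is the intersection of the valuation rings `D_P` with `P ≠ 0`, since these
include the localizations at the nonzero maximal `t`-proper ideals. They are discrete, and the
family has finite character because `P` is a minimal prime of each nonzero principal ideal that it
contains. -/
theorem IsPvMD.isKrullDomain [IsNoetherianRing D] (h : IsPvMD D) : IsKrullDomain D := by
  rw [isPvMD_iff D (FractionRing D)] at h
  let S : Set (ValuationSubring (FractionRing D)) := {V | ∃ (P : Ideal D) (_ : P.IsPrime),
    P ≠ ⊥ ∧ ∀ x, x ∈ V ↔ x ∈ locSubring P.primeCompl (FractionRing D)}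
  have hdvr : ∀ V ∈ S, IsDiscreteValuationRing V := by
    rintro V ⟨P, _, hP0, hV⟩
    exact isDiscreteValuationRing_of_mem_iff hP0 V hV
  refine ⟨S, hdvr, fun x ↦ ⟨fun hx ↦ ?_, ?_⟩, fun x hx0 ↦ ?_⟩
  · by_contra hxD
    obtain ⟨P, hP, hxP⟩ := exists_maximal_isTProper_of_notMem_range hxD
    have hPp := isPrime_of_maximal_isTProper hP
    obtain ⟨V, hV⟩ := h.isValuationPrime hP
    have hP0 : P ≠ ⊥ := by
      obtain ⟨a, b, hb, rfl⟩ := IsFractionRing.div_surjective (A := D) x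
      have hb0 : algebraMap D (FractionRing D) b ≠ 0 := by
        rw [Ne, FaithfulSMul.algebraMap_eq_zero_iff]
        exact nonZeroDivisors.ne_zero hb
      rintro rfl
      exact nonZeroDivisors.ne_zero hb (hxP b ⟨a, (mul_div_cancel₀ _ hb0).symm⟩)
    obtain ⟨s, hs, hsx⟩ := (hV x).mp (hx V ⟨P, hPp, hP0, hV⟩)
    exact hs (hxP s hsx)
  · rintro hx V ⟨P, _, -, hV⟩
    exact (hV x).mpr (range_le_locSubring hx)
  · have hS : ∀ V ∈ S, ∃ P : Ideal D, P.IsPrime ∧ ∀ x, x ∈ V ↔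
        ∃ s ∉ P, algebraMap D _ s * x ∈ (algebraMap D (FractionRing D)).range :=
      fun V ⟨P, hP, _, hV⟩ ↦ ⟨P, hP, hV⟩
    choose! P hP hPV using hS
    refine Set.Finite.of_injOn (f := P) (t := (Ideal.span {x}).minimalPrimes) ?_ ?_
      (Ideal.finite_minimalPrimes_of_isNoetherianRing D _)
    · rintro V ⟨hV, hVx⟩
      have := hP V hV
      have := hdvr V hV
      refine mem_minimalPrimes_of_isDiscreteValuationRing V (hPV V hV) hx0 ?_
      by_contra hxP
      have hx0' : algebraMap D (FractionRing D) x ≠ 0 := by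
        rwa [Ne, FaithfulSMul.algebraMap_eq_zero_iff]
      refine hVx (le_antisymm ?_ ?_)
      · rw [V.valuation_le_one_iff, hPV V hV]
        exact range_le_locSubring (S := (P V).primeCompl) ⟨x, rfl⟩
      · have : V.valuation (algebraMap D (FractionRing D) x)⁻¹ ≤ 1 := by
          rw [V.valuation_le_one_iff, hPV V hV]
          exact ⟨x, hxP, 1, by rw [map_one, mul_inv_cancel₀ hx0']⟩
        rw [map_inv₀] at this
        exact (inv_le_one₀ ((Valuation.pos_iff _).mpr hx0')).mp this
    · rintro V ⟨hV, -⟩ W ⟨hW, -⟩ hVW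
      ext x
      rw [hPV V hV, hPV W hW]
      simp only [hVW]

theorem tfae_of_isNoetherianRing [IsNoetherianRing D] :
    [IsPvMD D, IsLocallyPvMD D, IsPDomain D, IsEssentialDomain D, IsLocallyVDomain D,
      IsVDomain D, IsKrullDomain D, IsCICDomain D, IsIntegrallyClosed D].TFAE := by
  have h := tfae_of_isVFiniteConductorDomain (D := D) isVFiniteConductorDomain_of_isNoetherianRing
  tfae_have 1 ↔ 2 := h.out 0 1
  tfae_have 1 ↔ 3 := h.out 0 2
  tfae_have 1 ↔ 4 := h.out 0 3
  tfae_have 1 ↔ 5 := h.out 0 4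
  tfae_have 1 ↔ 6 := h.out 0 5
  tfae_have 1 → 7 := IsPvMD.isKrullDomain
  tfae_have 7 → 8 := IsKrullDomain.isCICDomain
  tfae_have 8 → 6 := IsCICDomain.isVDomain
  tfae_have 6 → 9 := IsVDomain.isIntegrallyClosed
  tfae_have 9 → 8 := fun _ ↦ isCICDomain_of_isIntegrallyClosed
  tfae_finish

end Noetherian

/-! ### Generalized GCD domains -/

section GCDSubring

variable {K : Type*} [Field K]

/-- The condition defining a GCD domain, for a subring `O` of a field: each finite set `T`
generates a fractional ideal `F` contained in a principal one `g O` such that `F⁻¹ = (g O)⁻¹`. -/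
def IsGCDSubring (O : Subring K) : Prop :=
  ∀ T : Finset K, ∃ g, (∀ t ∈ T, ∃ r ∈ O, t = r * g) ∧
    ∀ x, (∀ t ∈ T, x * t ∈ O) → x * g ∈ O

lemma isGCDSubring_of_isGCDMonoid (R : Type*) [CommRing R] [IsDomain R] [IsGCDMonoid R]
    [Algebra R K] [IsFractionRing R K] : IsGCDSubring (algebraMap R K).range := by
  classical
  have : GCDMonoid R := Classical.choice (by
    obtain ⟨h⟩ := ‹IsGCDMonoid R›
    exact ⟨h⟩)
  have h0 (r : R) (hr : r ≠ 0) : algebraMap R K r ≠ 0 := by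
    rwa [Ne, FaithfulSMul.algebraMap_eq_zero_iff]
  -- Two elements `a / d` and `b / d` have the greatest common divisor `gcd a b / d`.
  have pair (h c : K) : ∃ g, (∃ r ∈ (algebraMap R K).range, h = r * g) ∧
      (∃ r ∈ (algebraMap R K).range, c = r * g) ∧
      ∀ x, x * h ∈ (algebraMap R K).range → x * c ∈ (algebraMap R K).range →
        x * g ∈ (algebraMap R K).range := by
    obtain ⟨a, d, hd, rfl⟩ := IsFractionRing.div_surjective (A := R) h
    obtain ⟨b, e, he, rfl⟩ := IsFractionRing.div_surjective (A := R) c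
    have hd0 := h0 d (nonZeroDivisors.ne_zero hd)
    have he0 := h0 e (nonZeroDivisors.ne_zero he)
    refine ⟨algebraMap R K (gcd (a * e) (b * d)) / algebraMap R K (d * e), ?_, ?_, ?_⟩
    · obtain ⟨r, hr⟩ := gcd_dvd_left (a * e) (b * d)
      refine ⟨_, ⟨r, rfl⟩, ?_⟩
      have := congrArg (algebraMap R K) hr
      simp only [map_mul] at this ⊢
      field_simp
      linear_combination this
    · obtain ⟨r, hr⟩ := gcd_dvd_right (a * e) (b * d)
      refine ⟨_, ⟨r, rfl⟩, ?_⟩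
      have := congrArg (algebraMap R K) hr
      simp only [map_mul] at this ⊢
      field_simp
      linear_combination this
    · rintro x ⟨r, hr⟩ ⟨s, hs⟩
      obtain ⟨p, q, hq, rfl⟩ := IsFractionRing.div_surjective (A := R) x
      have hq0 := h0 q (nonZeroDivisors.ne_zero hq)
      have h1 : q * (d * e) ∣ p * (a * e) := by
        refine ⟨r, IsFractionRing.injective R K ?_⟩
        simp only [map_mul]
        rw [hr]
        field_simp
      have h2 : q * (d * e) ∣ p * (b * d) := by
        refine ⟨s, IsFractionRing.injective R K ?_⟩
        simp only [map_mul]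
        rw [hs]
        field_simp
      obtain ⟨w, hw⟩ := (dvd_gcd h1 h2).trans (gcd_mul_left' p (a * e) (b * d)).dvd
      refine ⟨w, ?_⟩
      have := congrArg (algebraMap R K) hw
      simp only [map_mul] at this ⊢
      field_simp
      linear_combination -this
  intro T
  induction T using Finset.induction_on with
  | empty => exact ⟨0, by simp, by simp⟩
  | insert t T _ ih =>
    obtain ⟨c, hc, hc'⟩ := ih
    obtain ⟨g, h1, ⟨r, hr, hrg⟩, h3⟩ := pair t c
    refine ⟨g, fun u hu ↦ ?_, fun x hx ↦ ?_⟩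
    · rcases Finset.mem_insert.mp hu with rfl | hu
      · exact h1
      · obtain ⟨r', hr', rfl⟩ := hc u hu
        exact ⟨r' * r, mul_mem hr' hr, by rw [hrg, mul_assoc]⟩
    · exact h3 x (hx t (Finset.mem_insert_self t T))
        (hc' x fun u hu ↦ hx u (Finset.mem_insert_of_mem hu))

lemma ne_zero_of_forall_eq_mul {O : Subring K} {T : Finset K} (hT : ∃ t ∈ T, t ≠ 0) {g : K}
    (hg : ∀ t ∈ T, ∃ r ∈ O, t = r * g) : g ≠ 0 := by
  rintro rfl
  obtain ⟨t, ht, ht0⟩ := hT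
  obtain ⟨r, -, hr⟩ := hg t ht
  exact ht0 (by simpa using hr)

lemma IsGCDSubring.isVSubring {O : Subring K} (h : IsGCDSubring O) : IsVSubring O := by
  intro T hT x hx
  obtain ⟨g, hg, hg'⟩ := h T
  have hg0 := ne_zero_of_forall_eq_mul hT hg
  have hinv (u) (hu : u ∈ T) : g⁻¹ * u ∈ O := by
    obtain ⟨r, hr, rfl⟩ := hg u hu
    rwa [mul_comm, mul_inv_cancel_right₀ hg0]
  have := hg' (x * g⁻¹) fun t ht ↦ by
    rw [mul_assoc, mul_comm g⁻¹]
    exact hx t ht g⁻¹ hinv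
  rwa [inv_mul_cancel_right₀ hg0] at this

end GCDSubring

section Invertible

variable {D : Type*} [CommRing D] [IsDomain D]

section

variable {K : Type*} [Field K] [Algebra D K] [IsFractionRing D K]

lemma exists_mul_eq_of_isUnit {A : FractionalIdeal D⁰ K} (hA : IsUnit A) (P : Ideal D)
    [P.IsPrime] : ∃ i ∈ A, ∃ j ∈ A⁻¹, ∃ s ∉ P, i * j = algebraMap D K s := by
  by_contra! hn
  have h1 : (1 : K) ∈ A * A⁻¹ := by
    rw [(FractionalIdeal.mul_inv_cancel_iff_isUnit K).mpr hA]
    exact FractionalIdeal.one_mem_one _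
  have key (z : K) (hz : z ∈ A * A⁻¹) : ∃ p ∈ P, algebraMap D K p = z := by
    refine FractionalIdeal.mul_induction_on hz (fun i hi j hj ↦ ?_) ?_
    · obtain ⟨p, hp⟩ := mem_one_iff_mem_range.mp
        (mul_inv_le_one A (FractionalIdeal.mul_mem_mul hi hj))
      exact ⟨p, by_contra fun hpP ↦ hn i hi j hj p hpP hp.symm, hp⟩
    · rintro _ _ ⟨p, hp, rfl⟩ ⟨q, hq, rfl⟩
      exact ⟨p + q, P.add_mem hp hq, map_add _ _ _⟩
  obtain ⟨p, hp, hp1⟩ := key 1 h1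
  rw [← map_one (algebraMap D K)] at hp1
  exact (P.ne_top_iff_one.mp (Ideal.IsPrime.ne_top ‹_›))
    (IsFractionRing.injective D K hp1 ▸ hp)

lemma isUnit_of_forall_exists_mul_eq {A : FractionalIdeal D⁰ K}
    (h : ∀ (M : Ideal D) [M.IsMaximal],
      ∃ i ∈ A, ∃ j ∈ A⁻¹, ∃ s ∉ M, i * j = algebraMap D K s) : IsUnit A := by
  rw [← FractionalIdeal.mul_inv_cancel_iff_isUnit K]
  refine le_antisymm (mul_inv_le_one A) fun x hx ↦ ?_
  obtain ⟨I, hI⟩ := FractionalIdeal.le_one_iff_exists_coeIdeal.mp (mul_inv_le_one A)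
  have hI1 : I = ⊤ := by
    by_contra hne
    obtain ⟨M, hM, hIM⟩ := Ideal.exists_le_maximal I hne
    obtain ⟨i, hi, j, hj, s, hs, hij⟩ := h M
    have : i * j ∈ A * A⁻¹ := FractionalIdeal.mul_mem_mul hi hj
    rw [hij, ← hI, FractionalIdeal.mem_coeIdeal] at this
    obtain ⟨s', hs', hss'⟩ := this
    exact hs (hIM (IsFractionRing.injective D K hss' ▸ hs'))
  change x ∈ A * A⁻¹
  rwa [← hI, hI1, FractionalIdeal.coeIdeal_top]

lemma inv_inv_of_isUnit {A : FractionalIdeal D⁰ K} (hA : IsUnit A) : A⁻¹⁻¹ = A := by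
  refine (FractionalIdeal.right_inverse_eq K A⁻¹ A ?_).symm
  rw [mul_comm]
  exact (FractionalIdeal.mul_inv_cancel_iff_isUnit K).mpr hA

/-- Over a P`v`MD the inverse of a finitely generated fractional ideal `H` satisfies
`(H⁻¹)⁻¹ = Y⁻¹` for a finite `Y ⊆ H⁻¹`, so that `(H⁻¹)⁻¹` commutes with localization. If in
addition all `D_M` are GCD domains then `H⁻¹` is locally principal, hence invertible. -/
lemma isUnit_inv_of_isFG (hD : IsPvMSubring (algebraMap D K).range)
    (hM : ∀ (M : Ideal D) [M.IsMaximal], IsGCDSubring (locSubring M.primeCompl K))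
    {H : FractionalIdeal D⁰ K} (hH : IsFG H) : IsUnit H⁻¹ := by
  obtain ⟨T, hT, hHT⟩ := isFG_iff_exists_span.mp hH
  obtain ⟨Y, hY, hY'⟩ := hD T hT
  refine isUnit_of_forall_exists_mul_eq fun M _ ↦ ?_
  obtain ⟨g, hg, hg'⟩ := hM M T
  have hg0 := ne_zero_of_forall_eq_mul hT hg
  obtain ⟨s₁, hs₁, h₁⟩ := exists_common_denominator (S := M.primeCompl) T (fun u ↦ g⁻¹ * u)
    fun u hu ↦ by
      obtain ⟨r, hr, rfl⟩ := hg u hu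
      rwa [mul_comm, mul_inv_cancel_right₀ hg0]
  obtain ⟨s₂, hs₂, h₂⟩ := exists_common_denominator (S := M.primeCompl) Y (fun y ↦ y * g)
    fun y hy ↦ hg' y fun t ht ↦ range_le_locSubring (hY y hy t ht)
  refine ⟨algebraMap D K s₁ * g⁻¹, ?_, algebraMap D K s₂ * g, ?_, s₁ * s₂,
    M.primeCompl.mul_mem hs₁ hs₂, ?_⟩
  · rw [mem_inv_iff_of_coe_eq_span hH.1 hHT]
    intro t ht
    rw [mul_assoc]
    exact h₁ t ht
  · rw [FractionalIdeal.mem_inv_iff (inv_ne_zero_of_ne_zero hH.1)]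
    intro z hz
    rw [mem_inv_iff_of_coe_eq_span hH.1 hHT] at hz
    rw [mem_one_iff_mem_range]
    refine hY' _ fun t ht y hy ↦ ?_
    convert mul_mem (h₂ y hy) (hz t ht) using 1
    ring
  · rw [map_mul]
    field_simp

end

lemma IsLocallyGCDDomain.isGCDSubring (h : IsLocallyGCDDomain D) (K : Type*) [Field K]
    [Algebra D K] [IsFractionRing D K] (M : Ideal D) [M.IsPrime] :
    IsGCDSubring (locSubring M.primeCompl K) := by
  obtain ⟨_, _, hr⟩ := exists_algebra_isFractionRing_localization M.primeCompl
    M.primeCompl_le_nonZeroDivisors K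
  have := h M
  rw [← hr]
  exact isGCDSubring_of_isGCDMonoid (Localization.AtPrime M)

/-- For invertible `I` and `J` one has `I ∩ J = (I⁻¹ + J⁻¹)⁻¹`. -/
lemma coeIdeal_inf_eq_inv {K : Type*} [Field K] [Algebra D K] [IsFractionRing D K] {I J : Ideal D}
    (hI : IsUnit (I : FractionalIdeal D⁰ K)) (hJ : IsUnit (J : FractionalIdeal D⁰ K)) :
    ((I ⊓ J : Ideal D) : FractionalIdeal D⁰ K) =
      ((I : FractionalIdeal D⁰ K)⁻¹ + (J : FractionalIdeal D⁰ K)⁻¹)⁻¹ := by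
  have hI0 := inv_ne_zero_of_ne_zero hI.ne_zero
  have hJ0 := inv_ne_zero_of_ne_zero hJ.ne_zero
  have hH0 : (I : FractionalIdeal D⁰ K)⁻¹ + (J : FractionalIdeal D⁰ K)⁻¹ ≠ 0 := fun h ↦
    hI0 (le_antisymm (h ▸ le_self_add) (FractionalIdeal.zero_le _))
  ext x
  rw [FractionalIdeal.coeIdeal_inf, FractionalIdeal.mem_inv_iff hH0]
  change x ∈ (I : FractionalIdeal D⁰ K) ∧ x ∈ (J : FractionalIdeal D⁰ K) ↔ _
  rw [← inv_inv_of_isUnit hI, ← inv_inv_of_isUnit hJ, FractionalIdeal.mem_inv_iff hI0,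
    FractionalIdeal.mem_inv_iff hJ0, inv_inv_of_isUnit hI, inv_inv_of_isUnit hJ]
  simp only [FractionalIdeal.mem_add]
  constructor
  · rintro ⟨h1, h2⟩ _ ⟨i, hi, j, hj, rfl⟩
    rw [mem_one_iff_mem_range, mul_add]
    exact add_mem (mem_one_iff_mem_range.mp (h1 i hi)) (mem_one_iff_mem_range.mp (h2 j hj))
  · intro h
    exact ⟨fun y hy ↦ h y ⟨y, hy, 0, FractionalIdeal.zero_mem _, add_zero y⟩,
      fun y hy ↦ h y ⟨0, FractionalIdeal.zero_mem _, y, hy, zero_add y⟩⟩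

theorem IsLocallyGCDDomain.isGGCDDomain (h : IsLocallyGCDDomain D)
    (hD : IsVFiniteConductorDomain D) : IsGGCDDomain D := by
  have hv : IsVDomain D := by
    rw [isVDomain_iff D (FractionRing D)]
    exact isVSubring_of_forall_locSubring fun M _ ↦ (h.isGCDSubring _ M).isVSubring
  have hp := (isPvMD_iff D (FractionRing D)).mp (hv.isPvMD hD)
  intro I J hI hJ
  have hunit {A : FractionalIdeal D⁰ (FractionRing D)} (hA : IsUnit A) : IsUnit A⁻¹ :=
    .of_mul_eq_one_right A ((FractionalIdeal.mul_inv_cancel_iff_isUnit _).mpr hA)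
  rw [coeIdeal_inf_eq_inv hI hJ]
  refine isUnit_inv_of_isFG hp (fun M _ ↦ h.isGCDSubring _ M) ⟨fun h0 ↦ ?_, ?_⟩
  · exact inv_ne_zero_of_ne_zero hI.ne_zero
      (le_antisymm (h0 ▸ le_self_add) (FractionalIdeal.zero_le _))
  · rw [FractionalIdeal.coe_add]
    exact (FractionalIdeal.fg_of_isUnit _ (hunit hI)).sup
      (FractionalIdeal.fg_of_isUnit _ (hunit hJ))

lemma algebraMap_dvd_localization_iff {P : Ideal D} [P.IsPrime] {a d : D} :
    algebraMap D (Localization.AtPrime P) a ∣ algebraMap D (Localization.AtPrime P) d ↔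
      ∃ s ∉ P, a ∣ s * d := by
  constructor
  · rintro ⟨c, hc⟩
    obtain ⟨c, s, rfl⟩ := IsLocalization.exists_mk'_eq P.primeCompl c
    refine ⟨s, s.2, c, ?_⟩
    refine IsLocalization.injective (Localization.AtPrime P) P.primeCompl_le_nonZeroDivisors ?_
    rw [map_mul, map_mul, hc, mul_left_comm, IsLocalization.mk'_spec']
  · rintro ⟨s, hs, h⟩
    have := map_dvd (algebraMap D (Localization.AtPrime P)) h
    rw [map_mul] at this
    exact (IsUnit.dvd_mul_left
      (IsLocalization.map_units (Localization.AtPrime P) (⟨s, hs⟩ : P.primeCompl))).mp this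

/-- A generator of the localization of the invertible ideal `a D ∩ b D` at `P` is a least common
multiple of `a` and `b` in `D_P`. -/
theorem IsGGCDDomain.isLocallyGCDDomain (h : IsGGCDDomain D) : IsLocallyGCDDomain D := by
  intro P _
  rw [isGCDMonoid_iff_exists_lcm]
  refine ⟨inferInstance, fun a b ↦ ?_⟩
  have hassoc (z : Localization.AtPrime P) :
      ∃ d : D, Associated z (algebraMap D (Localization.AtPrime P) d) := by
    obtain ⟨d, s, rfl⟩ := IsLocalization.exists_mk'_eq P.primeCompl z
    obtain ⟨u, hu⟩ := IsLocalization.map_units (Localization.AtPrime P) s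
    exact ⟨d, u, by rw [hu, IsLocalization.mk'_spec]⟩
  obtain ⟨a₀, ha⟩ := hassoc a
  obtain ⟨b₀, hb⟩ := hassoc b
  simp only [ha.dvd_iff_dvd_left, hb.dvd_iff_dvd_left]
  by_cases h0 : a₀ = 0 ∨ b₀ = 0
  · refine ⟨0, fun d ↦ ⟨fun hd ↦ ?_, fun hd ↦ ?_⟩⟩
    · rcases h0 with rfl | rfl
      · simpa using hd.1
      · simpa using hd.2
    · rw [zero_dvd_iff.mp hd]; exact ⟨dvd_zero _, dvd_zero _⟩
  push Not at h0
  have hspan (c : D) (hc : c ≠ 0) :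
      IsUnit ((Ideal.span {c} : Ideal D) : FractionalIdeal D⁰ (FractionRing D)) := by
    rw [FractionalIdeal.coeIdeal_span_singleton]
    exact .of_mul_eq_one _ (FractionalIdeal.spanSingleton_mul_inv _
      (by rwa [Ne, FaithfulSMul.algebraMap_eq_zero_iff]))
  set I : Ideal D := Ideal.span {a₀} ⊓ Ideal.span {b₀}
  obtain ⟨i, hi, j, hj, s, hs, hij⟩ :=
    exists_mul_eq_of_isUnit (h _ _ (hspan a₀ h0.1) (hspan b₀ h0.2)) P
  obtain ⟨c, hc, rfl⟩ := (FractionalIdeal.mem_coeIdeal _).mp hi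
  refine ⟨algebraMap D _ c, fun d ↦ ?_⟩
  obtain ⟨d₀, hd⟩ := hassoc d
  simp only [hd.dvd_iff_dvd_right]
  have hca : a₀ ∣ c := Ideal.mem_span_singleton.mp hc.1
  have hcb : b₀ ∣ c := Ideal.mem_span_singleton.mp hc.2
  refine ⟨fun ⟨h1, h2⟩ ↦ ?_, fun h ↦ ⟨(map_dvd _ hca).trans h, (map_dvd _ hcb).trans h⟩⟩
  obtain ⟨s₁, hs₁, h1⟩ := algebraMap_dvd_localization_iff.mp h1
  obtain ⟨s₂, hs₂, h2⟩ := algebraMap_dvd_localization_iff.mp h2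
  -- The element `e = s₁ s₂ d₀` lies in `I`, and `e j ∈ D` since `j ∈ I⁻¹`.
  have he : s₁ * s₂ * d₀ ∈ I := by
    refine ⟨Ideal.mem_span_singleton.mpr ?_, Ideal.mem_span_singleton.mpr ?_⟩
    · rw [mul_right_comm]; exact h1.mul_right _
    · rw [mul_assoc]; exact h2.mul_left _
  have hI0 : (I : FractionalIdeal D⁰ (FractionRing D)) ≠ 0 :=
    (h _ _ (hspan a₀ h0.1) (hspan b₀ h0.2)).ne_zero
  obtain ⟨k, hk⟩ := mem_one_iff_mem_range.mp ((FractionalIdeal.mem_inv_iff hI0).mp hj _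
    ((FractionalIdeal.mem_coeIdeal _).mpr ⟨_, he, rfl⟩))
  refine algebraMap_dvd_localization_iff.mpr ⟨s * (s₁ * s₂),
    P.primeCompl.mul_mem hs (P.primeCompl.mul_mem hs₁ hs₂), k, ?_⟩
  refine IsFractionRing.injective D (FractionRing D) ?_
  rw [map_mul _ c, hk, mul_assoc, map_mul, ← hij]
  ring

end Invertible

end MultIdeal

theorem mainTheorem8 (D : Type*) [CommRing D] [IsDomain D] :
    (IsNoetherianRing D → MultIdeal.IsVFiniteConductorDomain D) ∧
    (MultIdeal.IsVFiniteConductorDomain D →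
      [MultIdeal.IsPvMD D,
       MultIdeal.IsLocallyPvMD D,
       MultIdeal.IsPDomain D,
       MultIdeal.IsEssentialDomain D,
       MultIdeal.IsLocallyVDomain D,
       MultIdeal.IsVDomain D].TFAE) ∧
    (IsNoetherianRing D →
      [MultIdeal.IsPvMD D,
       MultIdeal.IsLocallyPvMD D,
       MultIdeal.IsPDomain D,
       MultIdeal.IsEssentialDomain D,
       MultIdeal.IsLocallyVDomain D,
       MultIdeal.IsVDomain D,
       MultIdeal.IsKrullDomain D,
       MultIdeal.IsCICDomain D,
       IsIntegrallyClosed D].TFAE) ∧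
    (MultIdeal.IsVFiniteConductorDomain D →
      (MultIdeal.IsGGCDDomain D ↔ MultIdeal.IsLocallyGCDDomain D)) :=
  ⟨fun _ ↦ MultIdeal.isVFiniteConductorDomain_of_isNoetherianRing,
    MultIdeal.tfae_of_isVFiniteConductorDomain, fun _ ↦ MultIdeal.tfae_of_isNoetherianRing,
    fun h ↦ ⟨MultIdeal.IsGGCDDomain.isLocallyGCDDomain, fun h' ↦ h'.isGGCDDomain h⟩⟩
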